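/- **Setting.** Fix a finite non-empty set $\mathcal A$ of agents and a countably infinite set of atomic propositions. Formulae are given by $\varphi ::= \bot \mid p \mid \varphi\wedge\varphi \mid \varphi\vee\varphi \mid \varphi\to\varphi \mid K_a\varphi \mid C\varphi$ with $a\in\mathcal A$; $\top := \bot\to\bot$. *Frames and models.* An *epistemic frame* $(W,\le,(R_a)_{a\in\mathcal A})$ is a non-empty poset $(W,\le)$ with binary relations $R_a$ on $W$ such that $w\le v$ and $v\,R_a\,u$ imply $w\,R_a\,u$. It is *reflexive* if every $R_a$ is reflexive, and an *S4 frame* if every $R_a$ is reflexive and transitive. A model adds a valuation $V:W\to\mathcal P(\mathrm{Prop})$ that is monotone in $\le$. Truth is defined as usual for $\bot,p,\wedge,\vee$; $w\models\varphi\to\psi$ iff $v\models\varphi$ implies $v\models\psi$ for all $v\ge w$; $w\models K_a\varphi$ iff $v\models\varphi$ for all $v$ with $w\,R_a\,v$; $w\models C\varphi$ iff $v\models\varphi$ for all $v$ with $w\,R^*\,v$, where $R^*$ is the reflexive transitive closure of $\bigcup_a R_a$. A formula is valid over a class of frames if it is true at every world of every model based on a frame of the class. *Sequents.* An annotated formula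 is $\varphi^{\mathsf u}$ (unfocused) or $\varphi^{\mathsf f}$ (in focus). A *sequent* $\Gamma\Rightarrow\Delta$ is a pair of finite sets of annotated formulae such that all formulae in $\Gamma$ are unfocused, at most one formula in $\Delta$ is in focus, and each formula in focus is of the form $C\psi$ or $K_aC\psi$. It is valid over a class of frames if $\bigwedge\Gamma^-\to\bigvee\Delta^-$ is, where $^-$ removes annotations (the empty conjunction is $\top$, the empty disjunction is $\bot$). *Rules* (conclusion $\Leftarrow$ premises; $\mathsf a\in\{\mathsf u,\mathsf f\}$; commas denote union of sets, so a principal formula may also be a side formula; conclusions and premises are sequents): - $\mathsf{id}$: $\Gamma,\varphi^{\mathsf u}\Rightarrow\varphi^{\mathsf a},\Delta$ and $\bot$: $\Gamma,\bot^{\mathsf u}\Rightarrow\Delta$, without premises (the axioms); - $\wedge\mathsf L$: $\Gamma,(\varphi\wedge\psi)^{\mathsf u}\Rightarrow\Delta\ \Leftarrow\ \Gamma,\varphi^{\mathsf u},\psi^{\mathsf u}\Rightarrow\Delta$; - $\wedge\mathsf R$: $\Gamma\Rightarrow(\varphi\wedge\psi)^{\mathsf u},\Delta\ \Leftarrow\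 \Gamma\Rightarrow\varphi^{\mathsf u},\Delta$ and $\Gamma\Rightarrow\psi^{\mathsf u},\Delta$; - $\vee\mathsf L$: $\Gamma,(\varphi\vee\psi)^{\mathsf u}\Rightarrow\Delta\ \Leftarrow\ \Gamma,\varphi^{\mathsf u}\Rightarrow\Delta$ and $\Gamma,\psi^{\mathsf u}\Rightarrow\Delta$; - $\vee\mathsf R$: $\Gamma\Rightarrow(\varphi\vee\psi)^{\mathsf u},\Delta\ \Leftarrow\ \Gamma\Rightarrow\varphi^{\mathsf u},\psi^{\mathsf u},\Delta$; - ${\to}\mathsf L$: $\Gamma,(\varphi\to\psi)^{\mathsf u}\Rightarrow\Delta\ \Leftarrow\ \Gamma\Rightarrow\varphi^{\mathsf u},\Delta$ and $\Gamma,\psi^{\mathsf u}\Rightarrow\Delta$; - ${\to}\mathsf R$: $\Gamma\Rightarrow(\varphi\to\psi)^{\mathsf u},\Delta\ \Leftarrow\ \Gamma,\varphi^{\mathsf u}\Rightarrow\psi^{\mathsf u}$; - focus rules: $\mathsf u$: $\Gamma\Rightarrow\varphi^{\mathsf f},\Delta\ \Leftarrow\ \Gamma\Rightarrow\varphi^{\mathsf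 u},\Delta$; and $\mathsf f$: $\Gamma\Rightarrow\varphi^{\mathsf u},\Delta\ \Leftarrow\ \Gamma\Rightarrow\varphi^{\mathsf f},\Delta$, where all of $\Delta$ is unfocused; - $C\mathsf L$: $\Gamma,C\varphi^{\mathsf u}\Rightarrow\Delta\ \Leftarrow\ \Gamma,\varphi^{\mathsf u},\{K_aC\varphi^{\mathsf u}\}_{a\in\mathcal A}\Rightarrow\Delta$; - $C\mathsf R$: $\Gamma\Rightarrow C\varphi^{\mathsf a},\Delta\ \Leftarrow\ \Gamma\Rightarrow\varphi^{\mathsf u},\Delta$ and $\Gamma\Rightarrow K_aC\varphi^{\mathsf a},\Delta$ for each $a\in\mathcal A$; - $\mathsf K_a$: $\Pi,K_a\Gamma\Rightarrow K_a\varphi^{\mathsf a},\Sigma\ \Leftarrow\ \Gamma\Rightarrow\varphi^{\mathsf a}$; - $\mathsf T_a$: $\Gamma,K_a\varphi^{\mathsf u}\Rightarrow\Delta\ \Leftarrow\ \Gamma,\varphi^{\mathsf u}\Rightarrow\Delta$; - $\mathsf{S4}_a$: $\Pi,K_a\Gamma\Rightarrow K_a\varphi^{\mathsf a},\Sigma\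 \Leftarrow\ K_a\Gamma\Rightarrow\varphi^{\mathsf a}$. The calculus $\mathrm{nICK}$ consists of all these rules except $\mathsf T_a,\mathsf{S4}_a$ ($a\in\mathcal A$); $\mathrm{nICKT}$ of all except $\mathsf{S4}_a$; $\mathrm{nICKS4}$ of all except $\mathsf K_a$. *Non-wellfounded proofs.* A *non-wellfounded proof* of $\sigma$ in one of these calculi is a finite or countably infinite rooted tree labelled by sequents, with root labelled by $\sigma$, such that every node with children forms together with its children an instance of a rule of the calculus, every leaf is labelled by an axiom, and every infinite branch has a suffix in which every sequent has a formula in focus and which passes through infinitely many applications of $C\mathsf R$ with principal formula in focus. **Theorem (Completeness of the non-wellfounded calculi).** Let $\sigma$ be a sequent. 1. If $\sigma$ is valid over the class of epistemic frames, then $\sigma$ has a non-wellfounded proof in $\mathrm{nICK}$. 2. If $\sigma$ is valid over the class of reflexive (epistemic) frames, then $\sigma$ has a non-wellfounded proof in $\mathrm{nICKT}$. 3. If $\sigma$ is valid over the class of S4 (epistemic) frames, then $\sigma$ has a non-wellfounded proof in $\mathrm{nICKS4}$. -/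

import Mathlib

universe u v w

namespace ICK

/-! ### Language -/

/-- Formulae of intuitionistic common knowledge logic over a type of agents and a type of atoms. -/
inductive Formula (Agent : Type u) (Atom : Type v) : Type (max u v)
  | bot : Formula Agent Atom
  | atom (p : Atom) : Formula Agent Atom
  | and (φ ψ : Formula Agent Atom) : Formula Agent Atom
  | or (φ ψ : Formula Agent Atom) : Formula Agent Atom
  | imp (φ ψ : Formula Agent Atom) : Formula Agent Atom
  | know (a : Agent) (φ : Formula Agent Atom) : Formula Agent Atom
  | common (φ : Formula Agent Atom) : Formula Agent Atom

namespace Formula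

variable {Agent : Type u} {Atom : Type v}

/-- Truth, defined as `⊥ → ⊥`. -/
def top : Formula Agent Atom := imp bot bot

/-- Conjunction of a list of formulae; the empty conjunction is truth. -/
def bigAnd : List (Formula Agent Atom) → Formula Agent Atom
  | [] => top
  | φ :: l => and φ (bigAnd l)

/-- Disjunction of a list of formulae; the empty disjunction is absurdity. -/
def bigOr : List (Formula Agent Atom) → Formula Agent Atom
  | [] => bot
  | φ :: l => or φ (bigOr l)

end Formula

/-! ### Frames, models, truth and validity -/

/-- A birelational frame: a non-empty poset of worlds with one accessibility relation per agent. -/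
structure BirelationalFrame (Agent : Type u) : Type (max u (w + 1)) where
  World : Type w
  nonempty : Nonempty World
  order : PartialOrder World
  R : Agent → World → World → Prop

namespace BirelationalFrame

variable {Agent : Type u}

instance (F : BirelationalFrame.{u, w} Agent) : PartialOrder F.World := F.order

instance (F : BirelationalFrame.{u, w} Agent) : Nonempty F.World := F.nonempty

/-- The union of the accessibility relations of all agents. -/
def RUnion (F : BirelationalFrame.{u, w} Agent) (x y : F.World) : Prop := ∃ a, F.R a x y

/-- The reflexive and transitive closure of the union of all accessibility relations. -/
def RStar (F : BirelationalFrame.{u, w} Agent) : F.World → F.World → Prop :=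
  Relation.ReflTransGen F.RUnion

/-- Epistemic frames: birelational frames with triangle confluence. -/
def IsEpistemic (F : BirelationalFrame.{u, w} Agent) : Prop :=
  ∀ (a : Agent) (x y z : F.World), x ≤ y → F.R a y z → F.R a x z

/-- Every accessibility relation is reflexive. -/
def IsReflexive (F : BirelationalFrame.{u, w} Agent) : Prop :=
  ∀ (a : Agent) (x : F.World), F.R a x x

/-- Every accessibility relation is transitive. -/
def IsTransitive (F : BirelationalFrame.{u, w} Agent) : Prop :=
  ∀ (a : Agent) (x y z : F.World), F.R a x y → F.R a y z → F.R a x z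

end BirelationalFrame

/-- The class of epistemic frames. -/
def epistemicFrames (Agent : Type u) : Set (BirelationalFrame.{u, w} Agent) :=
  {F | F.IsEpistemic}

/-- The class of reflexive (epistemic) frames. -/
def reflexiveFrames (Agent : Type u) : Set (BirelationalFrame.{u, w} Agent) :=
  {F | F.IsEpistemic ∧ F.IsReflexive}

/-- The class of S4 (epistemic) frames. -/
def s4Frames (Agent : Type u) : Set (BirelationalFrame.{u, w} Agent) :=
  {F | F.IsEpistemic ∧ F.IsReflexive ∧ F.IsTransitive}

/-- A birelational model: a birelational frame with a valuation monotone in the order. -/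
structure BirelationalModel (Agent : Type u) (Atom : Type v) : Type (max u v (w + 1)) where
  frame : BirelationalFrame.{u, w} Agent
  val : frame.World → Set Atom
  val_mono : ∀ x y : frame.World, x ≤ y → val x ⊆ val y

/-- The truth relation between worlds and formulae. -/
def BirelationalModel.Sat {Agent : Type u} {Atom : Type v}
    (M : BirelationalModel.{u, v, w} Agent Atom) :
    M.frame.World → Formula Agent Atom → Prop
  | _, .bot => False
  | x, .atom p => p ∈ M.val x
  | x, .and φ ψ => M.Sat x φ ∧ M.Sat x ψ
  | x, .or φ ψ => M.Sat x φ ∨ M.Sat x ψ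
  | x, .imp φ ψ => ∀ y, x ≤ y → M.Sat y φ → M.Sat y ψ
  | x, .know a φ => ∀ y, M.frame.R a x y → M.Sat y φ
  | x, .common φ => ∀ y, M.frame.RStar x y → M.Sat y φ

/-- A formula is valid over a class of frames if it is true at all worlds of all models based on
frames of the class. -/
def Formula.ValidOver {Agent : Type u} {Atom : Type v}
    (𝓕 : Set (BirelationalFrame.{u, w} Agent)) (φ : Formula Agent Atom) : Prop :=
  ∀ M : BirelationalModel.{u, v, w} Agent Atom, M.frame ∈ 𝓕 → ∀ x : M.frame.World, M.Sat x φ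

/-! ### Annotated formulae and sequents -/

/-- Annotations of formulae. -/
inductive Annotation : Type
  | unfocused : Annotation
  | focused : Annotation

/-- A formula together with an annotation. -/
abbrev AnnFormula (Agent : Type u) (Atom : Type v) : Type (max u v) :=
  Formula Agent Atom × Annotation

/-- An unfocused annotated formula. -/
abbrev unf {Agent : Type u} {Atom : Type v} (φ : Formula Agent Atom) : AnnFormula Agent Atom :=
  (φ, Annotation.unfocused)

/-- An annotated formula in focus. -/
abbrev foc {Agent : Type u} {Atom : Type v} (φ : Formula Agent Atom) : AnnFormula Agent Atom :=
  (φ, Annotation.focused)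

/-- An ordered pair of finite sets of annotated formulae. -/
@[ext] structure PreSequent (Agent : Type u) (Atom : Type v) : Type (max u v) where
  left : Finset (AnnFormula Agent Atom)
  right : Finset (AnnFormula Agent Atom)

/-- Sequents: all formulae on the left are unfocused, at most one formula on the right is in
focus, and every formula in focus has the shape `C ψ` or `K_a C ψ`. -/
@[ext] structure Sequent (Agent : Type u) (Atom : Type v) : Type (max u v)
    extends PreSequent Agent Atom where
  left_unfocused : ∀ x ∈ left, x.2 = Annotation.unfocused
  focus_unique : ∀ x ∈ right, ∀ y ∈ right,
    x.2 = Annotation.focused → y.2 = Annotation.focused → x = y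
  focus_shape : ∀ x ∈ right, x.2 = Annotation.focused →
    (∃ ψ, x.1 = Formula.common ψ) ∨ ∃ a ψ, x.1 = Formula.know a (Formula.common ψ)

/-- Some formula of the sequent is in focus. -/
def Sequent.HasFocus {Agent : Type u} {Atom : Type v} (σ : Sequent Agent Atom) : Prop :=
  ∃ φ, foc φ ∈ σ.right

/-- The plain formulae underlying a finite set of annotated formulae. -/
noncomputable def plain {Agent : Type u} {Atom : Type v} (Γ : Finset (AnnFormula Agent Atom)) :
    Finset (Formula Agent Atom) :=
  open Classical in Γ.image Prod.fst

/-- The interpretation `⋀ Γ⁻ → ⋁ Δ⁻` of a sequent `Γ ⇒ Δ`. -/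
noncomputable def Sequent.interp {Agent : Type u} {Atom : Type v} (σ : Sequent Agent Atom) :
    Formula Agent Atom :=
  .imp (.bigAnd (plain σ.left).toList) (.bigOr (plain σ.right).toList)

/-- A sequent is valid over a class of frames if its interpretation is. -/
def Sequent.ValidOver {Agent : Type u} {Atom : Type v}
    (𝓕 : Set (BirelationalFrame.{u, w} Agent)) (σ : Sequent Agent Atom) : Prop :=
  σ.interp.ValidOver 𝓕

/-! ### Rules and calculi -/

/-- Names of rules. For `commonR` the annotation of the principal formula is recorded. -/
inductive Rule (Agent : Type u) : Type u
  | ax : Rule Agent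
  | botL : Rule Agent
  | andL : Rule Agent
  | andR : Rule Agent
  | orL : Rule Agent
  | orR : Rule Agent
  | impL : Rule Agent
  | impR : Rule Agent
  | unfocus : Rule Agent
  | focus : Rule Agent
  | knowK (a : Agent) : Rule Agent
  | knowT (a : Agent) : Rule Agent
  | knowS4 (a : Agent) : Rule Agent
  | commonL : Rule Agent
  | commonR (α : Annotation) : Rule Agent

/-- `K_a Γ`: the modality `K_a` put in front of every member of `Γ`, annotations being kept. -/
noncomputable def knowSet {Agent : Type u} {Atom : Type v} (a : Agent)
    (Γ : Finset (AnnFormula Agent Atom)) : Finset (AnnFormula Agent Atom) :=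
  open Classical in Γ.image fun x => (Formula.know a x.1, x.2)

/-- The set of all `K_a C φ` (unfocused), for `a` ranging over the agents. -/
noncomputable def knowCommonSet {Agent : Type u} [Fintype Agent] {Atom : Type v}
    (φ : Formula Agent Atom) : Finset (AnnFormula Agent Atom) :=
  open Classical in Finset.univ.image fun a : Agent => unf (Formula.know a (Formula.common φ))

open Classical in
/-- `RuleInstance r σ l`: an instance of the rule `r` with conclusion `σ` and list of premises `l`.
As sequents are built from sets, the principal formula may also occur as a side formula. -/
inductive RuleInstance {Agent : Type u} [Fintype Agent] {Atom : Type v} :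
    Rule Agent → PreSequent Agent Atom → List (PreSequent Agent Atom) → Prop
  | ax (Γ Δ : Finset (AnnFormula Agent Atom)) (φ : Formula Agent Atom) (α : Annotation) :
      RuleInstance .ax ⟨insert (unf φ) Γ, insert (φ, α) Δ⟩ []
  | botL (Γ Δ : Finset (AnnFormula Agent Atom)) :
      RuleInstance .botL ⟨insert (unf .bot) Γ, Δ⟩ []
  | andL (Γ Δ : Finset (AnnFormula Agent Atom)) (φ ψ : Formula Agent Atom) :
      RuleInstance .andL ⟨insert (unf (.and φ ψ)) Γ, Δ⟩ [⟨insert (unf φ) (insert (unf ψ) Γ), Δ⟩]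
  | andR (Γ Δ : Finset (AnnFormula Agent Atom)) (φ ψ : Formula Agent Atom) :
      RuleInstance .andR ⟨Γ, insert (unf (.and φ ψ)) Δ⟩
        [⟨Γ, insert (unf φ) Δ⟩, ⟨Γ, insert (unf ψ) Δ⟩]
  | orL (Γ Δ : Finset (AnnFormula Agent Atom)) (φ ψ : Formula Agent Atom) :
      RuleInstance .orL ⟨insert (unf (.or φ ψ)) Γ, Δ⟩
        [⟨insert (unf φ) Γ, Δ⟩, ⟨insert (unf ψ) Γ, Δ⟩]
  | orR (Γ Δ : Finset (AnnFormula Agent Atom)) (φ ψ : Formula Agent Atom) :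
      RuleInstance .orR ⟨Γ, insert (unf (.or φ ψ)) Δ⟩ [⟨Γ, insert (unf φ) (insert (unf ψ) Δ)⟩]
  | impL (Γ Δ : Finset (AnnFormula Agent Atom)) (φ ψ : Formula Agent Atom) :
      RuleInstance .impL ⟨insert (unf (.imp φ ψ)) Γ, Δ⟩
        [⟨Γ, insert (unf φ) Δ⟩, ⟨insert (unf ψ) Γ, Δ⟩]
  | impR (Γ Δ : Finset (AnnFormula Agent Atom)) (φ ψ : Formula Agent Atom) :
      RuleInstance .impR ⟨Γ, insert (unf (.imp φ ψ)) Δ⟩ [⟨insert (unf φ) Γ, {unf ψ}⟩]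
  | unfocus (Γ Δ : Finset (AnnFormula Agent Atom)) (φ : Formula Agent Atom) :
      RuleInstance .unfocus ⟨Γ, insert (foc φ) Δ⟩ [⟨Γ, insert (unf φ) Δ⟩]
  | focus (Γ Δ : Finset (AnnFormula Agent Atom)) (φ : Formula Agent Atom)
      (hΔ : ∀ x ∈ Δ, x.2 = Annotation.unfocused) :
      RuleInstance .focus ⟨Γ, insert (unf φ) Δ⟩ [⟨Γ, insert (foc φ) Δ⟩]
  | knowK (a : Agent) (Γ Sₗ Sᵣ : Finset (AnnFormula Agent Atom)) (φ : Formula Agent Atom)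
      (α : Annotation) :
      RuleInstance (.knowK a) ⟨Sₗ ∪ knowSet a Γ, insert (.know a φ, α) Sᵣ⟩ [⟨Γ, {(φ, α)}⟩]
  | knowT (a : Agent) (Γ Δ : Finset (AnnFormula Agent Atom)) (φ : Formula Agent Atom) :
      RuleInstance (.knowT a) ⟨insert (unf (.know a φ)) Γ, Δ⟩ [⟨insert (unf φ) Γ, Δ⟩]
  | knowS4 (a : Agent) (Γ Sₗ Sᵣ : Finset (AnnFormula Agent Atom)) (φ : Formula Agent Atom)
      (α : Annotation) :
      RuleInstance (.knowS4 a) ⟨Sₗ ∪ knowSet a Γ, insert (.know a φ, α) Sᵣ⟩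
        [⟨knowSet a Γ, {(φ, α)}⟩]
  | commonL (Γ Δ : Finset (AnnFormula Agent Atom)) (φ : Formula Agent Atom) :
      RuleInstance .commonL ⟨insert (unf (.common φ)) Γ, Δ⟩
        [⟨insert (unf φ) (knowCommonSet φ ∪ Γ), Δ⟩]
  | commonR (Γ Δ : Finset (AnnFormula Agent Atom)) (φ : Formula Agent Atom) (α : Annotation) :
      RuleInstance (.commonR α) ⟨Γ, insert (.common φ, α) Δ⟩
        (⟨Γ, insert (unf φ) Δ⟩ ::
          (Finset.univ : Finset Agent).toList.map
            fun a => ⟨Γ, insert (.know a (.common φ), α) Δ⟩)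

/-- The three calculi. -/
inductive Calculus : Type
  | nICK : Calculus
  | nICKT : Calculus
  | nICKS4 : Calculus

/-- The rules of a calculus: all have the propositional, focus and common knowledge rules; in
addition `nICK` has the rules `K_a`, `nICKT` the rules `K_a` and `T_a`, and `nICKS4` the rules
`T_a` and `S4_a`. -/
def Calculus.HasRule {Agent : Type u} : Calculus → Rule Agent → Prop
  | .nICK, .knowT _ => False
  | .nICK, .knowS4 _ => False
  | .nICKT, .knowS4 _ => False
  | .nICKS4, .knowK _ => False
  | _, _ => True

/-- Axioms: conclusions of the rules without premises. -/
def Sequent.IsAxiomatic {Agent : Type u} [Fintype Agent] {Atom : Type v}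
    (σ : Sequent Agent Atom) : Prop :=
  RuleInstance .ax σ.toPreSequent [] ∨ RuleInstance .botL σ.toPreSequent []

/-! ### Non-wellfounded proofs -/

/-- A non-wellfounded pre-proof of `σ`: a rooted, finitely branching, possibly infinite tree. Nodes
are finite sequences of natural numbers, `s ++ [i]` being the `i`-th child of `s`. Every node is
labelled by a sequent, and every node with children also by the rule that is applied there; the
values of `label` and `rule` elsewhere are irrelevant. -/
structure PreProof {Agent : Type u} [Fintype Agent] {Atom : Type v} (P : Calculus)
    (σ : Sequent Agent Atom) : Type (max u v) where
  nodes : Set (List ℕ)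
  root_mem : [] ∈ nodes
  parent_mem : ∀ (s : List ℕ) (i : ℕ), s ++ [i] ∈ nodes → s ∈ nodes
  label : List ℕ → Sequent Agent Atom
  rule : List ℕ → Rule Agent
  root_label : label [] = σ
  /-- A parent node and all its children form an instance of a rule of the calculus. -/
  step : ∀ s ∈ nodes, (∃ i, s ++ [i] ∈ nodes) →
    P.HasRule (rule s) ∧
    ∃ k : ℕ, (∀ i, s ++ [i] ∈ nodes ↔ i < k) ∧
      RuleInstance (rule s) (label s).toPreSequent
        ((List.range k).map fun i => (label (s ++ [i])).toPreSequent)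

namespace PreProof

variable {Agent : Type u} [Fintype Agent] {Atom : Type v} {P : Calculus} {σ : Sequent Agent Atom}

/-- A node without children. -/
def IsLeaf (π : PreProof P σ) (s : List ℕ) : Prop :=
  s ∈ π.nodes ∧ ∀ i, s ++ [i] ∉ π.nodes

/-- An infinite branch: an infinite path starting at the root. -/
def IsInfiniteBranch (π : PreProof P σ) (ρ : ℕ → List ℕ) : Prop :=
  ρ 0 = [] ∧ ∀ n, ρ n ∈ π.nodes ∧ ∃ i, ρ (n + 1) = ρ n ++ [i]

/-- The suffix of `ρ` starting at position `N` is good: all its sequents have a formula in focus,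
and it passes infinitely often through the rule `commonR` with principal formula in focus. -/
def IsGoodSuffix (π : PreProof P σ) (ρ : ℕ → List ℕ) (N : ℕ) : Prop :=
  (∀ n, N ≤ n → (π.label (ρ n)).HasFocus) ∧
    {n | N ≤ n ∧ π.rule (ρ n) = Rule.commonR Annotation.focused}.Infinite

/-- A pre-proof is a proof if every leaf is an axiom and every infinite branch has a good
suffix. -/
def IsProof (π : PreProof P σ) : Prop :=
  (∀ s, π.IsLeaf s → (π.label s).IsAxiomatic) ∧
    ∀ ρ : ℕ → List ℕ, π.IsInfiniteBranch ρ → ∃ N, π.IsGoodSuffix ρ N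

end PreProof

/-- The sequent `σ` has a non-wellfounded proof in the calculus `P`. -/
def Provable {Agent : Type u} [Fintype Agent] {Atom : Type v} (P : Calculus)
    (σ : Sequent Agent Atom) : Prop :=
  ∃ π : PreProof P σ, π.IsProof

end ICK

/-! The proof is a canonical model construction over a finite set `Cl` closed under subformulae and
under unfolding `C φ` into `φ` and all `K_a C φ`. The worlds are the unprovable pairs over `Cl` that
are saturated, i.e. closed under all rules except the ones that discard context (`→R` and the modal
rules). These remaining rules supply the successors: intuitionistic order is inclusion of left
sides, and `y` is `a`-accessible from `x` if the left side of `y` contains what the modal rule for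
`a` keeps of the left side of `x`. As provability is closed under the rules (`Provable.of_rule`), an
unprovable sequent extends to a world (`exists_canonicalWorld`), and the truth lemma
`canonicalModel_truth` shows that the world refutes it.

The crucial case is `C φ` on the right, where a finite path to a world refuting `φ` is needed
(`CanonicalWorld.exists_path`). If there is none, proof search with `C φ` in focus never gets stuck:
unfold `C φ`, saturate, apply a modal rule, return to `C φ` in focus. Each side branch has a proof,
and a path that never leaves the loop unfolds the focused formula infinitely often.
`provable_of_progress` turns such a search into a non-wellfounded proof, contradicting
unprovability. -/

namespace ICK

variable {Agent : Type u} [Fintype Agent] {Atom : Type v} {P : Calculus}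

/-! ### Building proofs from graphs -/

section Unfolding

variable {X : Type*}

/-- The state reached from `x` by following an address in the graph with children `ch`. -/
def walk (ch : X → List X) (x : X) (s : List ℕ) : Option X :=
  s.foldl (fun o i => o.bind fun y => (ch y)[i]?) (some x)

theorem walk_append_singleton (ch : X → List X) (x : X) (s : List ℕ) (i : ℕ) :
    walk ch x (s ++ [i]) = (walk ch x s).bind fun y => (ch y)[i]? := by
  simp [walk]

/-- A graph whose local steps are rule instances, whose sinks are axioms and all of whose infinite
paths have good suffixes unfolds to a proof. -/
theorem provable_of_graph (lab : X → Sequent Agent Atom) (rule : X → Rule Agent)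
    (ch : X → List X) (I : X → Prop) (hI : ∀ x, I x → ∀ y ∈ ch x, I y)
    (step : ∀ x, I x → ch x ≠ [] → P.HasRule (rule x) ∧
      RuleInstance (rule x) (lab x).toPreSequent ((ch x).map fun y => (lab y).toPreSequent))
    (leaf : ∀ x, I x → ch x = [] → (lab x).IsAxiomatic) (x : X) (hx : I x)
    (branch : ∀ p : ℕ → X, p 0 = x → (∀ n, I (p n)) → (∀ n, p (n + 1) ∈ ch (p n)) →
      ∃ N, (∀ n, N ≤ n → (lab (p n)).HasFocus) ∧
        {n | N ≤ n ∧ rule (p n) = Rule.commonR Annotation.focused}.Infinite) :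
    Provable P (lab x) := by
  have hinv : ∀ s y, walk ch x s = some y → I y := by
    intro s
    induction s using List.reverseRecOn with
    | nil =>
      intro y hy
      simp only [walk, List.foldl_nil, Option.some.injEq] at hy
      exact hy ▸ hx
    | append_singleton s i ih =>
      intro y hy
      rw [walk_append_singleton, Option.bind_eq_some_iff] at hy
      obtain ⟨z, hz, hy⟩ := hy
      exact hI z (ih z hz) y (List.mem_of_getElem? hy)
  -- The default `x` is only taken at addresses outside the tree, where labels and rules are
  -- irrelevant.
  let st : List ℕ → X := fun s => (walk ch x s).getD x
  have hchild : ∀ s y, walk ch x s = some y → ∀ i,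
      (walk ch x (s ++ [i])).isSome ↔ i < (ch y).length := by
    intro s y hy i
    rw [walk_append_singleton, hy]
    simp
  let π : PreProof P (lab x) :=
    { nodes := {s | (walk ch x s).isSome}
      root_mem := by simp [walk]
      parent_mem := by
        intro s i h
        simp only [Set.mem_ofPred_eq, walk_append_singleton] at h ⊢
        cases hw : walk ch x s with
        | none => simp [hw] at h
        | some y => rfl
      label := fun s => lab (st s)
      rule := fun s => rule (st s)
      root_label := by simp [st, walk]
      step := by
        intro s hs hex
        obtain ⟨y, hy⟩ := Option.isSome_iff_exists.mp hs
        have hst : st s = y := by simp [st, hy]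
        obtain ⟨i, hi⟩ := hex
        have hne : ch y ≠ [] := by
          have := (hchild s y hy i).mp hi
          exact List.ne_nil_of_length_pos (by omega)
        obtain ⟨h1, h2⟩ := step y (hinv s y hy) hne
        refine ⟨by rw [hst]; exact h1, (ch y).length, hchild s y hy, ?_⟩
        rw [hst]
        convert h2 using 1
        refine List.ext_getElem (by simp) ?_
        intro i h h'
        simp only [List.length_map] at h'
        simp [st, walk_append_singleton, hy, List.getElem?_eq_getElem h'] }
  refine ⟨π, ?_, ?_⟩
  · rintro s ⟨hs, hl⟩
    obtain ⟨y, hy⟩ := Option.isSome_iff_exists.mp hs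
    have hst : st s = y := by simp [st, hy]
    change (lab (st s)).IsAxiomatic
    rw [hst]
    refine leaf y (hinv s y hy) ?_
    by_contra hne
    exact hl 0 ((hchild s y hy 0).mpr (List.length_pos_of_ne_nil hne))
  · rintro ρ ⟨h0, hρ⟩
    refine branch (fun n => st (ρ n)) (by simp [h0, st, walk]) ?_ ?_
    · intro n
      obtain ⟨y, hy⟩ := Option.isSome_iff_exists.mp (hρ n).1
      have hst : st (ρ n) = y := by simp [st, hy]
      simpa only [hst] using hinv _ y hy
    · intro n
      obtain ⟨y, hy⟩ := Option.isSome_iff_exists.mp (hρ n).1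
      have hst : st (ρ n) = y := by simp [st, hy]
      obtain ⟨i, hi⟩ := (hρ n).2
      have hm : (walk ch x (ρ (n + 1))).isSome := (hρ (n + 1)).1
      rw [hi] at hm
      have hlt := (hchild _ y hy i).mp hm
      have : st (ρ (n + 1)) = (ch y)[i] := by
        simp [st, hi, walk_append_singleton, hy, List.getElem?_eq_getElem hlt]
      simp only [hst, this]
      exact List.getElem_mem hlt

end Unfolding

/-! ### Coinduction for provability -/

theorem RuleInstance.isAxiomatic {r : Rule Agent} {σ : Sequent Agent Atom}
    (h : RuleInstance r σ.toPreSequent []) : σ.IsAxiomatic := by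
  generalize hl : ([] : List (PreSequent Agent Atom)) = l at h
  generalize hs : σ.toPreSequent = s at h
  cases h
  case ax => exact Or.inl (hs ▸ RuleInstance.ax _ _ _ _)
  case botL => exact Or.inr (hs ▸ RuleInstance.botL _ _)
  all_goals simp at hl

/-- The children of a node of a pre-proof, as a number. -/
theorem PreProof.exists_arity {σ : Sequent Agent Atom} (π : PreProof P σ) (s : List ℕ) :
    ∃ k : ℕ, s ∈ π.nodes → (∀ i, s ++ [i] ∈ π.nodes ↔ i < k) ∧ (k ≠ 0 → P.HasRule (π.rule s) ∧
      RuleInstance (π.rule s) (π.label s).toPreSequent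
        ((List.range k).map fun i => (π.label (s ++ [i])).toPreSequent)) := by
  -- Since `k` is chosen before membership of `s` is assumed, `choose` later yields a total arity
  -- function; the value 0 off the tree is junk.
  by_cases hs : s ∈ π.nodes
  · by_cases hc : ∃ i, s ++ [i] ∈ π.nodes
    · obtain ⟨h1, k, h2, h3⟩ := π.step s hs hc
      exact ⟨k, fun _ => ⟨h2, fun _ => ⟨h1, h3⟩⟩⟩
    · push Not at hc
      exact ⟨0, fun _ => ⟨fun i => by simp [hc i], fun h => absurd rfl h⟩⟩
  · exact ⟨0, fun h => absurd h hs⟩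

/-- Coinduction principle for provability: every member of `A` is the conclusion of a rule each of
whose premises is provable or again in `A`, where in the second case the conclusion has a formula
in focus and either a rank decreases or the rule unfolds a common knowledge formula in focus. -/
theorem provable_of_progress (A : Set (Sequent Agent Atom)) (rk : Sequent Agent Atom → ℕ)
    (hA : ∀ σ ∈ A, ∃ (r : Rule Agent) (l : List (Sequent Agent Atom)), P.HasRule r ∧
      RuleInstance r σ.toPreSequent (l.map Sequent.toPreSequent) ∧
      ∀ τ ∈ l, Provable P τ ∨ τ ∈ A ∧ σ.HasFocus ∧
        (rk τ < rk σ ∨ r = Rule.commonR Annotation.focused))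
    (σ : Sequent Agent Atom) (hσ : σ ∈ A) : Provable P σ := by
  classical
  -- Supplies the value of the chosen rule outside `A`.
  have : Inhabited (Rule Agent) := ⟨Rule.ax⟩
  choose! r l hr hl hprem using hA
  choose π hπ using fun τ : {τ : Sequent Agent Atom // Provable P τ} => τ.2
  choose k hk using fun (τ : {τ : Sequent Agent Atom // Provable P τ}) => (π τ).exists_arity
  -- A state is either a sequent still being searched or a position in the chosen proof of a
  -- provable sequent. A premise with a proof is at once replaced by the root of that proof, and the
  -- path then never leaves it.
  let X := Sequent Agent Atom ⊕ ({τ : Sequent Agent Atom // Provable P τ} × List ℕ)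
  let enter : Sequent Agent Atom → X := fun τ =>
    if h : Provable P τ then Sum.inr (⟨τ, h⟩, []) else Sum.inl τ
  let lab : X → Sequent Agent Atom := Sum.elim id fun q => (π q.1).label q.2
  let rule : X → Rule Agent := Sum.elim r fun q => (π q.1).rule q.2
  let ch : X → List X := Sum.elim (fun τ => (l τ).map enter) fun q =>
    (List.range (k q.1 q.2)).map fun i => Sum.inr (q.1, q.2 ++ [i])
  let I : X → Prop := Sum.elim (fun τ => τ ∈ A) fun q => q.2 ∈ (π q.1).nodes
  have hlab : ∀ τ, lab (enter τ) = τ := by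
    intro τ
    by_cases h : Provable P τ
    · simp [enter, h, lab, (π ⟨τ, h⟩).root_label]
    · simp [enter, h, lab]
  refine provable_of_graph (P := P) lab rule ch I ?_ ?_ ?_ (Sum.inl σ) hσ ?_
  · rintro (τ | ⟨τ, s⟩) hx y hy
    · simp only [ch, Sum.elim_inl, List.mem_map] at hy
      obtain ⟨τ', hτ', rfl⟩ := hy
      by_cases h : Provable P τ'
      · simpa [enter, h, I] using (π ⟨τ', h⟩).root_mem
      · simpa [enter, h, I] using ((hprem τ hx τ' hτ').resolve_left h).1
    · simp only [ch, Sum.elim_inr, List.mem_map, List.mem_range] at hy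
      obtain ⟨i, hi, rfl⟩ := hy
      exact ((hk τ s hx).1 i).mpr hi
  · rintro (τ | ⟨τ, s⟩) hx hne
    · refine ⟨hr τ hx, ?_⟩
      simpa [ch, hlab, Function.comp_def, lab, rule] using hl τ hx
    · have hk0 : k τ s ≠ 0 := by
        intro h
        exact hne (by simp [ch, h])
      obtain ⟨h1, h2⟩ := (hk τ s hx).2 hk0
      refine ⟨h1, ?_⟩
      simpa [ch, lab, rule, Function.comp_def] using h2
  · rintro (τ | ⟨τ, s⟩) hx he
    · have h := hl τ hx
      simp only [ch, Sum.elim_inl, List.map_eq_nil_iff] at he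
      rw [he] at h
      exact h.isAxiomatic
    · refine (hπ τ).1 s ⟨hx, fun i hi => ?_⟩
      have := ((hk τ s hx).1 i).mp hi
      simp only [ch, Sum.elim_inr, List.map_eq_nil_iff, List.range_eq_nil] at he
      omega
  · intro p h0 hI hp
    -- Either the path enters a chosen proof, and from then on is a branch of it with a good suffix,
    -- or it stays among the searched sequents forever and the progress condition applies.
    by_cases hex : ∃ n q, p n = Sum.inr q
    · have hfind := Nat.find_spec hex
      have hmin := fun m => Nat.find_min (m := m) hex
      generalize Nat.find hex = N at hfind hmin
      obtain ⟨⟨τ, s⟩, hq⟩ := hfind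
      -- At the first entry time the predecessor is a searched sequent, so the proof is entered at
      -- its root.
      have hs : s = [] := by
        cases N with
        | zero => simp [h0] at hq
        | succ N =>
          have hN := hmin N (Nat.lt_succ_self N)
          have hmem := hp N
          cases hpN : p N with
          | inr q => exact absurd ⟨q, hpN⟩ hN
          | inl τ' =>
            rw [hq, hpN] at hmem
            simp only [ch, Sum.elim_inl, List.mem_map] at hmem
            obtain ⟨τ'', -, h⟩ := hmem
            by_cases hP : Provable P τ''
            · simp only [enter, hP, dite_true] at h
              exact (Prod.mk.inj (Sum.inr.inj h)).2.symm
            · simp [enter, hP] at h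
      subst hs
      have hstay : ∀ m, ∃ s, p (N + m) = Sum.inr (τ, s) := by
        intro m
        induction m with
        | zero => exact ⟨[], hq⟩
        | succ m ih =>
          obtain ⟨s, hs⟩ := ih
          have := hp (N + m)
          rw [hs] at this
          simp only [ch, Sum.elim_inr, List.mem_map, List.mem_range] at this
          obtain ⟨i, -, hi⟩ := this
          exact ⟨_, hi.symm⟩
      choose ρ hρ using hstay
      have hbr : (π τ).IsInfiniteBranch ρ := by
        refine ⟨?_, fun n => ⟨?_, ?_⟩⟩
        · have := hρ 0
          rw [Nat.add_zero, hq] at this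
          exact (Prod.mk.inj (Sum.inr.inj this)).2.symm
        · have := hI (N + n)
          rwa [hρ] at this
        · have := hp (N + n)
          rw [hρ n, Nat.add_assoc, hρ (n + 1)] at this
          simp only [ch, Sum.elim_inr, List.mem_map, List.mem_range] at this
          obtain ⟨i, -, hi⟩ := this
          exact ⟨i, (Prod.mk.inj (Sum.inr.inj hi)).2.symm⟩
      obtain ⟨M, hM1, hM2⟩ := (hπ τ).2 ρ hbr
      refine ⟨N + M, ?_, ?_⟩
      · intro n hn
        obtain ⟨m, rfl⟩ := Nat.exists_eq_add_of_le (show N ≤ n by omega)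
        rw [hρ]
        exact hM1 m (by omega)
      · refine (hM2.image (f := fun m => N + m) (fun a _ b _ h => by simpa using h)).mono ?_
        rintro _ ⟨m, ⟨hm, hm'⟩, rfl⟩
        refine ⟨by simpa using hm, ?_⟩
        change rule (p (N + m)) = _
        rw [hρ]
        exact hm'
    · have hall : ∀ n, ∃ τ, p n = Sum.inl τ := by
        intro n
        cases h : p n with
        | inl τ => exact ⟨τ, rfl⟩
        | inr q => exact absurd ⟨n, q, h⟩ hex
      choose q hq using hall
      have hqA : ∀ n, q n ∈ A := fun n => by
        have := hI n
        rwa [hq] at this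
      have hnext : ∀ n, (q n).HasFocus ∧
          (rk (q (n + 1)) < rk (q n) ∨ r (q n) = Rule.commonR Annotation.focused) := by
        intro n
        have := hp n
        rw [hq n, hq (n + 1)] at this
        simp only [ch, Sum.elim_inl, List.mem_map] at this
        obtain ⟨τ, hτ, h⟩ := this
        by_cases hP : Provable P τ
        · simp [enter, hP] at h
        · simp only [enter, hP, dite_false] at h
          obtain rfl := Sum.inl.inj h
          exact ((hprem _ (hqA n) _ hτ).resolve_left hP).2
      refine ⟨0, fun n _ => ?_, ?_⟩
      · rw [hq]
        exact (hnext n).1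
      · refine Set.infinite_of_forall_exists_gt fun N => ?_
        by_contra hcon
        push Not at hcon
        -- Without focused unfoldings after time `N` the rank drops at every step, which is
        -- impossible for more than `rk (q (N + 1))` steps.
        have hdec : ∀ m, rk (q (N + 1 + m)) + m ≤ rk (q (N + 1)) := by
          intro m
          induction m with
          | zero => simp
          | succ m ih =>
            rcases (hnext (N + 1 + m)).2 with h | h
            · change rk (q (N + 1 + m + 1)) + (m + 1) ≤ _
              omega
            · have := hcon (N + 1 + m) ⟨Nat.zero_le _, by rw [hq]; exact h⟩
              omega
        have := hdec (rk (q (N + 1)) + 1)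
        omega

/-- Provability is closed under the rules of the calculus. -/
theorem Provable.of_rule {σ : Sequent Agent Atom} {r : Rule Agent}
    {l : List (Sequent Agent Atom)} (hr : P.HasRule r)
    (hl : RuleInstance r σ.toPreSequent (l.map Sequent.toPreSequent))
    (h : ∀ τ ∈ l, Provable P τ) : Provable P σ :=
  provable_of_progress {σ} (fun _ => 0)
    (by rintro _ rfl; exact ⟨r, l, hr, hl, fun τ hτ => Or.inl (h τ hτ)⟩) σ rfl

/-! ### Closed sets of formulae -/

/-- Sets of formulae closed under subformulae and under unfolding of common knowledge. -/
structure IsClosed (Cl : Finset (Formula Agent Atom)) : Prop where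
  and : ∀ φ ψ, Formula.and φ ψ ∈ Cl → φ ∈ Cl ∧ ψ ∈ Cl
  or : ∀ φ ψ, Formula.or φ ψ ∈ Cl → φ ∈ Cl ∧ ψ ∈ Cl
  imp : ∀ φ ψ, Formula.imp φ ψ ∈ Cl → φ ∈ Cl ∧ ψ ∈ Cl
  know : ∀ a φ, Formula.know a φ ∈ Cl → φ ∈ Cl
  common : ∀ φ, Formula.common φ ∈ Cl → φ ∈ Cl ∧ ∀ a, Formula.know a (Formula.common φ) ∈ Cl

open Classical in
/-- The closure of a formula. -/
noncomputable def closure : Formula Agent Atom → Finset (Formula Agent Atom)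
  | .bot => {.bot}
  | .atom p => {.atom p}
  | .and φ ψ => insert (.and φ ψ) (closure φ ∪ closure ψ)
  | .or φ ψ => insert (.or φ ψ) (closure φ ∪ closure ψ)
  | .imp φ ψ => insert (.imp φ ψ) (closure φ ∪ closure ψ)
  | .know a φ => insert (.know a φ) (closure φ)
  | .common φ => insert (.common φ)
      (Finset.univ.image (fun a => .know a (.common φ)) ∪ closure φ)

theorem self_mem_closure (φ : Formula Agent Atom) : φ ∈ closure φ := by
  cases φ <;> simp [closure]

omit [Fintype Agent] in
theorem IsClosed.union [DecidableEq (Formula Agent Atom)] {S T : Finset (Formula Agent Atom)}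
    (hS : IsClosed S) (hT : IsClosed T) : IsClosed (S ∪ T) := by
  constructor
  all_goals
    intros
    simp only [Finset.mem_union] at *
  · grind [hS.and, hT.and]
  · grind [hS.or, hT.or]
  · grind [hS.imp, hT.imp]
  · grind [hS.know, hT.know]
  · grind [hS.common, hT.common]

/-- Unfolding `C φ` adds only the formulae `K_a C φ`, whose immediate subformula `C φ` is already
present, so one round of unfolding suffices. -/
theorem isClosed_closure (φ : Formula Agent Atom) : IsClosed (closure φ) := by
  induction φ with
  | bot => constructor <;> simp [closure]
  | atom p => constructor <;> simp [closure]
  | and φ ψ hφ hψ | or φ ψ hφ hψ | imp φ ψ hφ hψ =>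
    classical
    obtain ⟨c1, c2, c3, c4, c5⟩ := hφ.union hψ
    have h1 := self_mem_closure φ
    have h2 := self_mem_closure ψ
    constructor
    all_goals
      intros
      simp only [closure, Finset.mem_insert, Finset.mem_union, reduceCtorEq, false_or,
        Formula.and.injEq, Formula.or.injEq, Formula.imp.injEq] at *
      grind
  | know a φ h =>
    obtain ⟨c1, c2, c3, c4, c5⟩ := h
    have h1 := self_mem_closure φ
    constructor
    all_goals
      intros
      simp only [closure, Finset.mem_insert, reduceCtorEq, false_or, Formula.know.injEq] at *
      grind
  | common φ h =>
    obtain ⟨c1, c2, c3, c4, c5⟩ := h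
    have h1 := self_mem_closure φ
    constructor
    all_goals
      intros
      simp only [closure, Finset.mem_insert, Finset.mem_union, Finset.mem_image, Finset.mem_univ,
        true_and, reduceCtorEq, false_or, exists_false, Formula.common.injEq,
        Formula.know.injEq] at *
      grind

theorem exists_isClosed (S : Finset (Formula Agent Atom)) :
    ∃ Cl : Finset (Formula Agent Atom), IsClosed Cl ∧ S ⊆ Cl := by
  classical
  induction S using Finset.induction_on with
  | empty => exact ⟨∅, by constructor <;> simp, subset_rfl⟩
  | insert φ S _ ih =>
    obtain ⟨Cl, h, hS⟩ := ih
    refine ⟨closure φ ∪ Cl, (isClosed_closure φ).union h, ?_⟩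
    exact Finset.insert_subset (Finset.mem_union_left _ (self_mem_closure φ))
      (hS.trans Finset.subset_union_right)

/-! ### Sequents from plain sets -/

/-- Formulae that may be in focus. -/
def Focusable (Agent : Type u) (Atom : Type v) : Type (max u v) :=
  {χ : Formula Agent Atom // (∃ ψ, χ = .common ψ) ∨ ∃ a ψ, χ = .know a (.common ψ)}

/-- `C φ` as a formula that may be in focus. -/
def Focusable.common (φ : Formula Agent Atom) : Focusable Agent Atom :=
  ⟨.common φ, Or.inl ⟨φ, rfl⟩⟩

/-- `K_a C φ` as a formula that may be in focus. -/
def Focusable.know (a : Agent) (φ : Formula Agent Atom) : Focusable Agent Atom :=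
  ⟨.know a (.common φ), Or.inr ⟨a, φ, rfl⟩⟩

open Classical in
/-- All formulae of a set, unfocused. -/
noncomputable def unfSet (Γ : Finset (Formula Agent Atom)) : Finset (AnnFormula Agent Atom) :=
  Γ.image unf

open Classical in
/-- All formulae of a set, unfocused, together with at most one formula in focus. -/
noncomputable def focSet (Δ : Finset (Formula Agent Atom)) :
    Option (Focusable Agent Atom) → Finset (AnnFormula Agent Atom)
  | none => unfSet Δ
  | some χ => insert (foc χ.1) (unfSet Δ)

omit [Fintype Agent] in
theorem mem_unfSet {Γ : Finset (Formula Agent Atom)} {x : AnnFormula Agent Atom} :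
    x ∈ unfSet Γ ↔ x.1 ∈ Γ ∧ x.2 = .unfocused := by
  obtain ⟨φ, α⟩ := x
  simp only [unfSet, Finset.mem_image, Prod.mk.injEq]
  constructor
  · rintro ⟨ψ, h, rfl, rfl⟩
    exact ⟨h, rfl⟩
  · rintro ⟨h, rfl⟩
    exact ⟨φ, h, rfl, rfl⟩

omit [Fintype Agent] in
theorem mem_focSet {Δ : Finset (Formula Agent Atom)} {o : Option (Focusable Agent Atom)}
    {x : AnnFormula Agent Atom} :
    x ∈ focSet Δ o ↔ (x.1 ∈ Δ ∧ x.2 = .unfocused) ∨ ∃ χ, o = some χ ∧ x = foc χ.1 := by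
  cases o with
  | none => simp [focSet, mem_unfSet]
  | some χ => simp [focSet, mem_unfSet, or_comm]

open Classical in
omit [Fintype Agent] in
theorem insert_unfSet (Γ : Finset (Formula Agent Atom)) (φ : Formula Agent Atom) :
    insert (unf φ) (unfSet Γ) = unfSet (insert φ Γ) :=
  (Finset.image_insert _ _ _).symm

omit [Fintype Agent] in
theorem unfSet_singleton (φ : Formula Agent Atom) : unfSet {φ} = {unf φ} := by
  classical
  exact Finset.image_singleton _ _

open Classical in
omit [Fintype Agent] in
theorem insert_focSet (Δ : Finset (Formula Agent Atom)) (o : Option (Focusable Agent Atom))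
    (φ : Formula Agent Atom) : insert (unf φ) (focSet Δ o) = focSet (insert φ Δ) o := by
  cases o with
  | none => exact insert_unfSet _ _
  | some χ => rw [focSet, focSet, Finset.insert_comm, insert_unfSet]

/-- The sequent `Γ ⇒ Δ` with all formulae unfocused and possibly one further formula in focus on
the right. -/
noncomputable def mkSeq (Γ Δ : Finset (Formula Agent Atom)) (o : Option (Focusable Agent Atom)) :
    Sequent Agent Atom where
  left := unfSet Γ
  right := focSet Δ o
  left_unfocused := fun _ hx => (mem_unfSet.mp hx).2
  focus_unique := by
    intro x hx y hy hx2 hy2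
    rw [mem_focSet] at hx hy
    rcases hx with ⟨-, hx⟩ | ⟨χ, rfl, rfl⟩
    · simp [hx] at hx2
    · rcases hy with ⟨-, hy⟩ | ⟨χ', h, rfl⟩
      · simp [hy] at hy2
      · cases h
        rfl
  focus_shape := by
    intro x hx hx2
    rw [mem_focSet] at hx
    rcases hx with ⟨-, hx⟩ | ⟨χ, rfl, rfl⟩
    · simp [hx] at hx2
    · exact χ.2

omit [Fintype Agent] in
theorem mkSeq_toPreSequent (Γ Δ : Finset (Formula Agent Atom))
    (o : Option (Focusable Agent Atom)) :
    (mkSeq Γ Δ o).toPreSequent = ⟨unfSet Γ, focSet Δ o⟩ := rfl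

open Classical in
/-- Putting a formula on the right into focus preserves provability. -/
theorem Provable.focus {Γ Δ : Finset (Formula Agent Atom)} {χ : Focusable Agent Atom}
    (h : Provable P (mkSeq Γ (insert χ.1 Δ) none)) : Provable P (mkSeq Γ Δ (some χ)) := by
  refine Provable.of_rule (r := .unfocus) (l := [mkSeq Γ (insert χ.1 Δ) none])
    (by cases P <;> trivial) ?_ (by simpa using h)
  have := RuleInstance.unfocus (unfSet Γ) (unfSet Δ) χ.1
  rw [insert_unfSet] at this
  exact this

theorem provable_of_mem_of_mem {Γ Δ : Finset (Formula Agent Atom)} {φ : Formula Agent Atom}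
    (hΓ : φ ∈ Γ) (hΔ : φ ∈ Δ) : Provable P (mkSeq Γ Δ none) := by
  classical
  refine Provable.of_rule (r := .ax) (l := []) (by cases P <;> trivial) ?_ (by simp)
  have := RuleInstance.ax (unfSet Γ) (unfSet Δ) φ .unfocused
  rw [insert_unfSet, insert_unfSet, Finset.insert_eq_of_mem hΓ, Finset.insert_eq_of_mem hΔ] at this
  exact this

theorem provable_of_bot_mem {Γ Δ : Finset (Formula Agent Atom)}
    (hΓ : Formula.bot ∈ Γ) : Provable P (mkSeq Γ Δ none) := by
  classical
  refine Provable.of_rule (r := .botL) (l := []) (by cases P <;> trivial) ?_ (by simp)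
  have := RuleInstance.botL (unfSet Γ) (unfSet Δ)
  rw [insert_unfSet, Finset.insert_eq_of_mem hΓ] at this
  exact this

/-! ### The modal rules, read from conclusion to premise -/

open Classical in
/-- The part of `Γ` that is kept by the modal rule for `a` read from conclusion to premise. -/
noncomputable def boxPart (P : Calculus) (a : Agent) (Γ : Finset (Formula Agent Atom)) :
    Finset (Formula Agent Atom) :=
  match P with
  | .nICKS4 => Γ.filter fun φ => ∃ ψ, φ = .know a ψ
  | _ => Γ.preimage (Formula.know a) fun _ _ _ _ h => (Formula.know.inj h).2

omit [Fintype Agent] in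
theorem mem_boxPart_of_ne (hP : P ≠ .nICKS4) {a : Agent} {Γ : Finset (Formula Agent Atom)}
    {φ : Formula Agent Atom} : φ ∈ boxPart P a Γ ↔ Formula.know a φ ∈ Γ := by
  cases P with
  | nICK => exact Finset.mem_preimage (hf := fun _ _ _ _ h => (Formula.know.inj h).2)
  | nICKT => exact Finset.mem_preimage (hf := fun _ _ _ _ h => (Formula.know.inj h).2)
  | nICKS4 => exact absurd rfl hP

omit [Fintype Agent] in
theorem mem_boxPart_s4 {a : Agent} {Γ : Finset (Formula Agent Atom)} {φ : Formula Agent Atom} :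
    φ ∈ boxPart .nICKS4 a Γ ↔ φ ∈ Γ ∧ ∃ ψ, φ = Formula.know a ψ := by
  classical
  exact Finset.mem_filter

omit [Fintype Agent] in
theorem boxPart_mono (P : Calculus) (a : Agent) {Γ Γ' : Finset (Formula Agent Atom)}
    (h : Γ ⊆ Γ') : boxPart P a Γ ⊆ boxPart P a Γ' := by
  intro φ
  by_cases hP : P = .nICKS4
  · subst hP
    rw [mem_boxPart_s4, mem_boxPart_s4]
    exact fun hφ => ⟨h hφ.1, hφ.2⟩
  · rw [mem_boxPart_of_ne hP, mem_boxPart_of_ne hP]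
    exact fun hφ => h hφ

omit [Fintype Agent] in
theorem IsClosed.boxPart_subset {Cl : Finset (Formula Agent Atom)} (hCl : IsClosed Cl)
    (P : Calculus) (a : Agent) {Γ : Finset (Formula Agent Atom)} (h : Γ ⊆ Cl) :
    boxPart P a Γ ⊆ Cl := by
  intro φ
  by_cases hP : P = .nICKS4
  · subst hP
    rw [mem_boxPart_s4]
    exact fun hφ => h hφ.1
  · rw [mem_boxPart_of_ne hP]
    exact fun hφ => hCl.know a φ (h hφ)

open Classical in
/-- The modal rule of the calculus. -/
theorem exists_modal_rule (P : Calculus) (a : Agent) (Γ : Finset (Formula Agent Atom))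
    (φ : Formula Agent Atom) (α : Annotation) (S : Finset (AnnFormula Agent Atom)) :
    ∃ r : Rule Agent, P.HasRule r ∧ RuleInstance r ⟨unfSet Γ, insert (.know a φ, α) S⟩
      [⟨unfSet (boxPart P a Γ), {(φ, α)}⟩] := by
  have hinj : Function.Injective (Formula.know a : Formula Agent Atom → _) :=
    fun _ _ h => (Formula.know.inj h).2
  set B := Γ.preimage (Formula.know a) hinj.injOn with hB
  -- The weakening part of the rule may be all of `Γ`; the boxed formulae are then absorbed and the
  -- conclusion has exactly `Γ` on the left.
  have hsub : unfSet Γ ∪ knowSet a (unfSet B) = unfSet Γ := by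
    rw [Finset.union_eq_left]
    intro x hx
    simp only [knowSet, Finset.mem_image, mem_unfSet, hB, Finset.mem_preimage] at hx
    obtain ⟨y, ⟨h1, h2⟩, rfl⟩ := hx
    exact mem_unfSet.mpr ⟨h1, h2⟩
  have hK := RuleInstance.knowK a (unfSet B) (unfSet Γ) S φ α
  have hS := RuleInstance.knowS4 a (unfSet B) (unfSet Γ) S φ α
  rw [hsub] at hK hS
  cases P with
  | nICK => exact ⟨.knowK a, trivial, hK⟩
  | nICKT => exact ⟨.knowK a, trivial, hK⟩
  | nICKS4 =>
    refine ⟨.knowS4 a, trivial, ?_⟩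
    convert hS using 3
    ext ⟨ψ, β⟩
    simp only [knowSet, mem_unfSet, boxPart, Finset.mem_filter, Finset.mem_image, hB,
      Finset.mem_preimage, Prod.mk.injEq]
    constructor
    · rintro ⟨⟨h1, χ, rfl⟩, rfl⟩
      exact ⟨(χ, .unfocused), ⟨h1, rfl⟩, rfl, rfl⟩
    · rintro ⟨⟨χ, γ⟩, ⟨h1, h2⟩, rfl, rfl⟩
      exact ⟨⟨h1, χ, rfl⟩, h2⟩

/-! ### Saturation -/

/-- Pairs of sets of formulae that are closed under the local rules of the calculus. -/
structure Saturated (P : Calculus) (Γ Δ : Finset (Formula Agent Atom)) : Prop where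
  andL : ∀ φ ψ, Formula.and φ ψ ∈ Γ → φ ∈ Γ ∧ ψ ∈ Γ
  andR : ∀ φ ψ, Formula.and φ ψ ∈ Δ → φ ∈ Δ ∨ ψ ∈ Δ
  orL : ∀ φ ψ, Formula.or φ ψ ∈ Γ → φ ∈ Γ ∨ ψ ∈ Γ
  orR : ∀ φ ψ, Formula.or φ ψ ∈ Δ → φ ∈ Δ ∧ ψ ∈ Δ
  impL : ∀ φ ψ, Formula.imp φ ψ ∈ Γ → φ ∈ Δ ∨ ψ ∈ Γ
  knowL : P ≠ .nICK → ∀ a φ, Formula.know a φ ∈ Γ → φ ∈ Γ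
  commonL : ∀ φ, Formula.common φ ∈ Γ → φ ∈ Γ ∧ ∀ a, Formula.know a (.common φ) ∈ Γ
  commonR : ∀ φ, Formula.common φ ∈ Δ → φ ∈ Δ ∨ ∃ a, Formula.know a (.common φ) ∈ Δ

open Classical in
theorem knowCommonSet_union (φ : Formula Agent Atom) (Γ : Finset (Formula Agent Atom)) :
    knowCommonSet φ ∪ unfSet Γ =
      unfSet (Finset.univ.image (fun a => Formula.know a (.common φ)) ∪ Γ) := by
  rw [unfSet, unfSet, Finset.image_union, Finset.image_image]
  rfl

/-- A pair that is not saturated can be extended by a local rule, whatever is in focus. -/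
theorem exists_rule_of_not_saturated {Cl : Finset (Formula Agent Atom)} (hCl : IsClosed Cl)
    {Γ Δ : Finset (Formula Agent Atom)} (hΓ : Γ ⊆ Cl) (hΔ : Δ ⊆ Cl) (h : ¬ Saturated P Γ Δ)
    (o : Option (Focusable Agent Atom)) :
    ∃ (r : Rule Agent) (l : List (Finset (Formula Agent Atom) × Finset (Formula Agent Atom))),
      P.HasRule r ∧ RuleInstance r (mkSeq Γ Δ o).toPreSequent
        (l.map fun q => (mkSeq q.1 q.2 o).toPreSequent) ∧
      ∀ q ∈ l, Γ ⊆ q.1 ∧ Δ ⊆ q.2 ∧ q.1 ⊆ Cl ∧ q.2 ⊆ Cl ∧ (¬ q.1 ⊆ Γ ∨ ¬ q.2 ⊆ Δ) := by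
  classical
  by_contra hno
  push Not at hno
  apply h
  -- Every rule is applied with its principal formula kept as a side formula, so premises only grow.
  -- If no instance enlarges all its premises, each has a premise that adds nothing, and this is the
  -- matching saturation clause.
  have key : ∀ (r : Rule Agent)
      (l : List (Finset (Formula Agent Atom) × Finset (Formula Agent Atom))), P.HasRule r →
      RuleInstance r ⟨unfSet Γ, focSet Δ o⟩ (l.map fun q => ⟨unfSet q.1, focSet q.2 o⟩) →
      (∀ q ∈ l, Γ ⊆ q.1 ∧ Δ ⊆ q.2 ∧ q.1 ⊆ Cl ∧ q.2 ⊆ Cl) → ∃ q ∈ l, q.1 ⊆ Γ ∧ q.2 ⊆ Δ := by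
    intro r l h1 h2 h3
    obtain ⟨q, hq, h4⟩ := hno r l h1 h2
    obtain ⟨h5, h6, h7, h8⟩ := h3 q hq
    exact ⟨q, hq, h4 h5 h6 h7 h8⟩
  constructor
  · intro φ ψ hm
    have hr := RuleInstance.andL (unfSet Γ) (focSet Δ o) φ ψ
    simp only [insert_unfSet, Finset.insert_eq_of_mem hm] at hr
    have hc := hCl.and φ ψ (hΓ hm)
    have := key .andL [(insert φ (insert ψ Γ), Δ)] (by cases P <;> trivial) hr
    simp only [List.forall_mem_cons, List.exists_mem_cons_iff, List.not_mem_nil, false_implies,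
      false_and, exists_false, implies_true] at this
    grind
  · intro φ ψ hm
    have hr := RuleInstance.andR (unfSet Γ) (focSet Δ o) φ ψ
    simp only [insert_focSet, Finset.insert_eq_of_mem hm] at hr
    have hc := hCl.and φ ψ (hΔ hm)
    have := key .andR [(Γ, insert φ Δ), (Γ, insert ψ Δ)] (by cases P <;> trivial) hr
    simp only [List.forall_mem_cons, List.exists_mem_cons_iff, List.not_mem_nil, false_implies,
      false_and, exists_false, implies_true] at this
    grind
  · intro φ ψ hm
    have hr := RuleInstance.orL (unfSet Γ) (focSet Δ o) φ ψ
    simp only [insert_unfSet, Finset.insert_eq_of_mem hm] at hr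
    have hc := hCl.or φ ψ (hΓ hm)
    have := key .orL [(insert φ Γ, Δ), (insert ψ Γ, Δ)] (by cases P <;> trivial) hr
    simp only [List.forall_mem_cons, List.exists_mem_cons_iff, List.not_mem_nil, false_implies,
      false_and, exists_false, implies_true] at this
    grind
  · intro φ ψ hm
    have hr := RuleInstance.orR (unfSet Γ) (focSet Δ o) φ ψ
    simp only [insert_focSet, Finset.insert_eq_of_mem hm] at hr
    have hc := hCl.or φ ψ (hΔ hm)
    have := key .orR [(Γ, insert φ (insert ψ Δ))] (by cases P <;> trivial) hr
    simp only [List.forall_mem_cons, List.exists_mem_cons_iff, List.not_mem_nil, false_implies,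
      false_and, exists_false, implies_true] at this
    grind
  · intro φ ψ hm
    have hr := RuleInstance.impL (unfSet Γ) (focSet Δ o) φ ψ
    simp only [insert_focSet, insert_unfSet, Finset.insert_eq_of_mem hm] at hr
    have hc := hCl.imp φ ψ (hΓ hm)
    have := key .impL [(Γ, insert φ Δ), (insert ψ Γ, Δ)] (by cases P <;> trivial) hr
    simp only [List.forall_mem_cons, List.exists_mem_cons_iff, List.not_mem_nil, false_implies,
      false_and, exists_false, implies_true] at this
    grind
  · intro hP a φ hm
    have hr := RuleInstance.knowT a (unfSet Γ) (focSet Δ o) φ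
    simp only [insert_unfSet, Finset.insert_eq_of_mem hm] at hr
    have hc := hCl.know a φ (hΓ hm)
    have := key (.knowT a) [(insert φ Γ, Δ)] (by cases P <;> trivial) hr
    simp only [List.forall_mem_cons, List.exists_mem_cons_iff, List.not_mem_nil, false_implies,
      false_and, exists_false, implies_true] at this
    grind
  · intro φ hm
    have hr := RuleInstance.commonL (unfSet Γ) (focSet Δ o) φ
    simp only [knowCommonSet_union, insert_unfSet, Finset.insert_eq_of_mem hm] at hr
    obtain ⟨q, hq, h1, -⟩ := key .commonL
      [(insert φ (Finset.univ.image (fun a => Formula.know a (.common φ)) ∪ Γ), Δ)]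
      (by cases P <;> trivial) hr (by
        have := hCl.common φ (hΓ hm)
        grind)
    rw [List.mem_singleton] at hq
    subst hq
    exact ⟨h1 (by simp), fun a => h1 (by simp)⟩
  · intro φ hm
    -- The unfocused copy of `C φ` is unfolded, so the formula in focus stays untouched.
    have hr := RuleInstance.commonR (unfSet Γ) (focSet Δ o) φ .unfocused
    simp only [insert_focSet, Finset.insert_eq_of_mem hm] at hr
    obtain ⟨q, hq, -, h1⟩ := key (.commonR .unfocused) ((Γ, insert φ Δ) ::
      (Finset.univ : Finset Agent).toList.map fun a => (Γ, insert (.know a (.common φ)) Δ))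
      (by cases P <;> trivial) (by simpa [Function.comp_def] using hr) (by
        have := hCl.common φ (hΔ hm)
        grind)
    simp only [List.mem_cons, List.mem_map, Finset.mem_toList, Finset.mem_univ, true_and] at hq
    rcases hq with rfl | ⟨a, rfl⟩
    · exact Or.inl (h1 (by simp))
    · exact Or.inr ⟨a, h1 (by simp)⟩

open Classical in
/-- The number of formulae of `Cl` missing (unfocused) in a sequent, on both sides. -/
noncomputable def deficit (Cl : Finset (Formula Agent Atom)) (σ : Sequent Agent Atom) : ℕ :=
  (unfSet Cl \ σ.left).card + (unfSet Cl \ σ.right).card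

omit [Fintype Agent] in
theorem deficit_lt {Cl Γ Δ Γ' Δ' : Finset (Formula Agent Atom)} (hΓ : Γ ⊆ Γ') (hΔ : Δ ⊆ Δ')
    (hΓ' : Γ' ⊆ Cl) (hΔ' : Δ' ⊆ Cl) (h : ¬ Γ' ⊆ Γ ∨ ¬ Δ' ⊆ Δ)
    (o : Option (Focusable Agent Atom)) :
    deficit Cl (mkSeq Γ' Δ' o) < deficit Cl (mkSeq Γ Δ o) := by
  classical
  have h1 : unfSet Cl \ unfSet Γ' ⊆ unfSet Cl \ unfSet Γ := by
    intro x
    simp only [Finset.mem_sdiff, mem_unfSet]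
    grind
  have h2 : unfSet Cl \ focSet Δ' o ⊆ unfSet Cl \ focSet Δ o := by
    intro x
    simp only [Finset.mem_sdiff, mem_unfSet, mem_focSet]
    grind
  rcases h with h | h
  · obtain ⟨φ, hφ, hφ'⟩ := Finset.not_subset.mp h
    refine add_lt_add_of_lt_of_le (Finset.card_lt_card ⟨h1, fun hc => ?_⟩) (Finset.card_le_card h2)
    have := hc (Finset.mem_sdiff.mpr ⟨mem_unfSet.mpr ⟨hΓ' hφ, rfl⟩,
      fun (hm : unf φ ∈ unfSet Γ) => hφ' (mem_unfSet.mp hm).1⟩)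
    exact (Finset.mem_sdiff.mp this).2 (mem_unfSet.mpr ⟨hφ, rfl⟩)
  · obtain ⟨φ, hφ, hφ'⟩ := Finset.not_subset.mp h
    refine add_lt_add_of_le_of_lt (Finset.card_le_card h1) (Finset.card_lt_card ⟨h2, fun hc => ?_⟩)
    have := hc (Finset.mem_sdiff.mpr ⟨mem_unfSet.mpr ⟨hΔ' hφ, rfl⟩,
      fun (hm : unf φ ∈ focSet Δ o) => by simp [mem_focSet, hφ'] at hm⟩)
    exact (Finset.mem_sdiff.mp this).2 (mem_focSet.mpr (Or.inl ⟨hφ, rfl⟩))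

/-! ### Canonical worlds -/

/-- Worlds of the canonical model: saturated unprovable sequents over `Cl`. -/
structure IsWorld (P : Calculus) (Cl Γ Δ : Finset (Formula Agent Atom)) : Prop where
  left_subset : Γ ⊆ Cl
  right_subset : Δ ⊆ Cl
  saturated : Saturated P Γ Δ
  not_provable : ¬ Provable P (mkSeq Γ Δ none)

/-- The type of canonical worlds. -/
def CanonicalWorld (P : Calculus) (Cl : Finset (Formula Agent Atom)) : Type (max u v) :=
  {p : Finset (Formula Agent Atom) × Finset (Formula Agent Atom) // IsWorld P Cl p.1 p.2}

/-- Finiteness later allows the worlds to be indexed by a type in the universe of the frames. -/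
instance (P : Calculus) (Cl : Finset (Formula Agent Atom)) : Finite (CanonicalWorld P Cl) := by
  classical
  refine Set.Finite.subset (Finset.finite_toSet (Cl.powerset ×ˢ Cl.powerset)) ?_
  intro p hp
  simpa using ⟨hp.left_subset, hp.right_subset⟩

namespace CanonicalWorld

variable {Cl : Finset (Formula Agent Atom)}

/-- The formulae on the left. -/
def L (x : CanonicalWorld P Cl) : Finset (Formula Agent Atom) := x.1.1

/-- The formulae on the right. -/
def R (x : CanonicalWorld P Cl) : Finset (Formula Agent Atom) := x.1.2

/-- Accessibility for some agent. -/
def Access (x y : CanonicalWorld P Cl) : Prop := ∃ a, boxPart P a x.L ⊆ y.L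

end CanonicalWorld

/-- If the pair is not saturated, some local rule strictly enlarges it in every premise. Not all
premises are provable, so one passes to an unprovable premise; the deficit with respect to `Cl`
drops and the process ends. -/
theorem exists_canonicalWorld {Cl : Finset (Formula Agent Atom)} (hCl : IsClosed Cl)
    {Γ Δ : Finset (Formula Agent Atom)} (hΓ : Γ ⊆ Cl) (hΔ : Δ ⊆ Cl)
    (h : ¬ Provable P (mkSeq Γ Δ none)) :
    ∃ x : CanonicalWorld P Cl, Γ ⊆ x.L ∧ Δ ⊆ x.R := by
  generalize hn : deficit Cl (mkSeq Γ Δ none) = n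
  induction n using Nat.strong_induction_on generalizing Γ Δ with
  | _ n ih =>
    by_cases hs : Saturated P Γ Δ
    · exact ⟨⟨(Γ, Δ), ⟨hΓ, hΔ, hs, h⟩⟩, subset_rfl, subset_rfl⟩
    · obtain ⟨r, l, hr, hi, hl⟩ := exists_rule_of_not_saturated hCl hΓ hΔ hs none
      have : ∃ q ∈ l, ¬ Provable P (mkSeq q.1 q.2 none) := by
        by_contra hc
        push Not at hc
        refine h (Provable.of_rule (l := l.map fun q => mkSeq q.1 q.2 none) hr ?_ ?_)
        · simpa [Function.comp_def] using hi
        · simp only [List.mem_map]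
          rintro _ ⟨q, hq, rfl⟩
          exact hc q hq
      obtain ⟨q, hq, hnp⟩ := this
      obtain ⟨h1, h2, h3, h4, h5⟩ := hl q hq
      obtain ⟨x, hx1, hx2⟩ := ih _ (hn ▸ deficit_lt h1 h2 h3 h4 h5 none) h3 h4 hnp rfl
      exact ⟨x, h1.trans hx1, h2.trans hx2⟩

/-- A refuted `K_a C φ` is witnessed by a path to a world refuting `φ`: otherwise the canonical
worlds refuting it would provide a proof with `C φ` in focus. -/
theorem CanonicalWorld.exists_path {Cl : Finset (Formula Agent Atom)} (hCl : IsClosed Cl)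
    (x : CanonicalWorld P Cl) (a : Agent) (φ : Formula Agent Atom)
    (hx : Formula.know a (.common φ) ∈ x.R) :
    ∃ y, Relation.ReflTransGen Access x y ∧ φ ∈ y.R := by
  classical
  by_contra hbad
  -- No world extending the pair reaches a world refuting `φ`. This persists when the pair grows.
  let Bad : Finset (Formula Agent Atom) → Finset (Formula Agent Atom) → Prop := fun Γ Δ =>
    ∀ x : CanonicalWorld P Cl, Γ ⊆ x.L → Δ ⊆ x.R →
      ¬ ∃ y, Relation.ReflTransGen Access x y ∧ φ ∈ y.R
  have hC : Formula.common φ ∈ Cl := hCl.know a _ (x.2.right_subset hx)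
  obtain ⟨hφ, hKC⟩ := hCl.common φ hC
  -- The two stages of the search loop: `C φ` in focus and alone on the right, or some `K_b C φ` in
  -- focus while the rest is being saturated. Unprovability is included so that a saturated member
  -- yields a canonical world.
  let A : Set (Sequent Agent Atom) := {σ | ¬ Provable P σ ∧
    ((∃ Γ, Γ ⊆ Cl ∧ Bad Γ ∅ ∧ σ = mkSeq Γ ∅ (some (.common φ))) ∨
      ∃ Γ Δ b, Γ ⊆ Cl ∧ Δ ⊆ Cl ∧ Bad Γ (insert (.know b (.common φ)) Δ) ∧
        σ = mkSeq Γ Δ (some (.know b φ)))}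
  -- Saturation lowers the deficit, and the modal rule, which resets the context, returns to rank 0.
  -- The only step that may raise the rank is the focused unfolding of `C φ`.
  let rk : Sequent Agent Atom → ℕ := fun σ =>
    if foc (.common φ) ∈ σ.right then 0 else deficit Cl σ + 1
  have hrk : ∀ Γ Δ b, rk (mkSeq Γ Δ (some (.know b φ))) =
      deficit Cl (mkSeq Γ Δ (some (.know b φ))) + 1 := by
    intro Γ Δ b
    refine if_neg ?_
    simp only [mkSeq, mem_focSet]
    rintro (⟨-, h⟩ | ⟨χ, h, h'⟩)
    · cases h
    · cases h
      cases h'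
  have hfoc : ∀ Γ Δ (χ : Focusable Agent Atom), (mkSeq Γ Δ (some χ)).HasFocus := fun Γ Δ χ =>
    ⟨χ.1, mem_focSet.mpr (Or.inr ⟨χ, rfl, rfl⟩)⟩
  have hmain := provable_of_progress (P := P) A rk (by
    rintro σ ⟨hnp, ⟨Γ, hΓ, hB, rfl⟩ | ⟨Γ, Δ, b, hΓ, hΔ, hB, rfl⟩⟩
    · refine ⟨.commonR .focused, mkSeq Γ {φ} none ::
        (Finset.univ : Finset Agent).toList.map fun b => mkSeq Γ ∅ (some (.know b φ)),
        by cases P <;> trivial, ?_, ?_⟩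
      · have := RuleInstance.commonR (unfSet Γ) (unfSet ∅) φ .focused
        rw [insert_unfSet] at this
        simpa [Function.comp_def, mkSeq, focSet, Focusable.common, Focusable.know] using this
      · simp only [List.mem_cons, List.mem_map, Finset.mem_toList, Finset.mem_univ, true_and]
        rintro τ (rfl | ⟨b, rfl⟩)
        -- If `Γ ⇒ φ` were unprovable it would extend to a world refuting `φ`, reached from itself
        -- by the empty path.
        · left
          by_contra hτ
          obtain ⟨y, hy1, hy2⟩ := exists_canonicalWorld hCl hΓ (by simpa using hφ) hτ
          exact hB y hy1 (by simp) ⟨y, .refl, by simpa using hy2⟩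
        · by_cases hτ : Provable P (mkSeq Γ ∅ (some (.know b φ)))
          · exact Or.inl hτ
          · exact Or.inr ⟨⟨hτ, Or.inr ⟨Γ, ∅, b, hΓ, by simp,
              fun y h1 _ => hB y h1 (by simp), rfl⟩⟩, hfoc _ _ _, Or.inr trivial⟩
    · by_cases hs : Saturated P Γ Δ
      · have hs' : Saturated P Γ (insert (.know b (.common φ)) Δ) := by
          constructor
          all_goals
            intros
            try simp only [Finset.mem_insert, reduceCtorEq, false_or] at *
          · grind [hs.andL]
          · grind [hs.andR]
          · grind [hs.orL]
          · grind [hs.orR]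
          · grind [hs.impL]
          · grind [hs.knowL]
          · grind [hs.commonL]
          · grind [hs.commonR]
        have hnp' : ¬ Provable P (mkSeq Γ (insert (.know b (.common φ)) Δ) none) :=
          fun h => hnp (Provable.focus h)
        let y : CanonicalWorld P Cl := ⟨(Γ, insert (.know b (.common φ)) Δ),
          ⟨hΓ, Finset.insert_subset (hKC b) hΔ, hs', hnp'⟩⟩
        obtain ⟨r, hr, hi⟩ := exists_modal_rule P b Γ (.common φ) .focused (unfSet Δ)
        refine ⟨r, [mkSeq (boxPart P b Γ) ∅ (some (.common φ))], hr, ?_, ?_⟩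
        · simpa [mkSeq, focSet, unfSet, Focusable.know, Focusable.common] using hi
        · simp only [List.mem_singleton]
          rintro τ rfl
          by_cases hτ : Provable P (mkSeq (boxPart P b Γ) ∅ (some (.common φ)))
          · exact Or.inl hτ
          · refine Or.inr ⟨⟨hτ, Or.inl ⟨_, hCl.boxPart_subset P b hΓ, ?_, rfl⟩⟩, hfoc _ _ _,
              Or.inl ?_⟩
            -- Every world extending the modal premise is accessible from `y`, so a path from it
            -- would prolong to a path from `y`.
            · rintro z hz - ⟨t, hzt, ht⟩
              exact hB y subset_rfl subset_rfl ⟨t, .head ⟨b, hz⟩ hzt, ht⟩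
            · rw [hrk]
              have : rk (mkSeq (boxPart P b Γ) ∅ (some (.common φ))) = 0 :=
                if_pos (mem_focSet.mpr (Or.inr ⟨_, rfl, rfl⟩))
              omega
      · obtain ⟨r, l, hr, hi, hl⟩ := exists_rule_of_not_saturated hCl hΓ hΔ hs (some (.know b φ))
        refine ⟨r, l.map fun q => mkSeq q.1 q.2 (some (.know b φ)), hr,
          by simpa [Function.comp_def] using hi, ?_⟩
        simp only [List.mem_map]
        rintro _ ⟨q, hq, rfl⟩
        obtain ⟨h1, h2, h3, h4, h5⟩ := hl q hq
        by_cases hτ : Provable P (mkSeq q.1 q.2 (some (.know b φ)))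
        · exact Or.inl hτ
        · refine Or.inr ⟨⟨hτ, Or.inr ⟨q.1, q.2, b, h3, h4, fun y hy1 hy2 => hB y (h1.trans hy1)
            ((Finset.insert_subset_insert _ h2).trans hy2), rfl⟩⟩, hfoc _ _ _, Or.inl ?_⟩
          rw [hrk, hrk]
          exact Nat.add_lt_add_right (deficit_lt h1 h2 h3 h4 h5 _) 1)
  have h1 : Provable P (mkSeq (boxPart P a x.L) ∅ (some (.common φ))) := by
    by_contra h
    refine h (hmain _ ⟨h, Or.inl ⟨_, hCl.boxPart_subset P a x.2.left_subset, ?_, rfl⟩⟩)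
    rintro z hz - ⟨t, hzt, ht⟩
    exact hbad ⟨t, .head ⟨a, hz⟩ hzt, ht⟩
  have h2 : Provable P (mkSeq x.L x.R (some (.know a φ))) := by
    obtain ⟨r, hr, hi⟩ := exists_modal_rule P a x.L (.common φ) .focused (unfSet x.R)
    refine Provable.of_rule (l := [_]) hr ?_ (List.forall_mem_singleton.mpr h1)
    simpa [mkSeq, focSet, unfSet, Focusable.know, Focusable.common] using hi
  -- The unfocused `K_a C φ` in `x.R` can be put into focus while also being kept as a side formula,
  -- so the proof just found proves `x` itself.
  refine x.2.not_provable (Provable.of_rule (r := .focus) (l := [_]) (by cases P <;> trivial) ?_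
    (List.forall_mem_singleton.mpr h2))
  have := RuleInstance.focus (unfSet x.L) (unfSet x.R) (.know a (.common φ))
    fun y hy => (mem_unfSet.mp hy).2
  rw [insert_unfSet, Finset.insert_eq_of_mem hx] at this
  exact this

/-! ### The canonical model -/

namespace CanonicalWorld

variable {Cl : Finset (Formula Agent Atom)}

theorem disjoint (x : CanonicalWorld P Cl) {φ : Formula Agent Atom} (hL : φ ∈ x.L) : φ ∉ x.R :=
  fun hR => x.2.not_provable (provable_of_mem_of_mem hL hR)

theorem bot_notMem (x : CanonicalWorld P Cl) : Formula.bot ∉ x.L :=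
  fun h => x.2.not_provable (provable_of_bot_mem h)

/-- The premise of `→R` keeps the left side but forgets the right one, which is why the order of the
canonical model compares left sides only. -/
theorem exists_of_imp_mem (hCl : IsClosed Cl) (x : CanonicalWorld P Cl) {φ ψ : Formula Agent Atom}
    (h : Formula.imp φ ψ ∈ x.R) : ∃ y : CanonicalWorld P Cl, x.L ⊆ y.L ∧ φ ∈ y.L ∧ ψ ∈ y.R := by
  classical
  obtain ⟨hφ, hψ⟩ := hCl.imp φ ψ (x.2.right_subset h)
  have hnp : ¬ Provable P (mkSeq (insert φ x.L) {ψ} none) := by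
    intro hp
    refine x.2.not_provable (Provable.of_rule (r := .impR) (l := [_]) (by cases P <;> trivial) ?_
      (List.forall_mem_singleton.mpr hp))
    have := RuleInstance.impR (unfSet x.L) (unfSet x.R) φ ψ
    rw [insert_unfSet, insert_unfSet, Finset.insert_eq_of_mem h, ← unfSet_singleton] at this
    exact this
  obtain ⟨y, h1, h2⟩ := exists_canonicalWorld hCl
    (Finset.insert_subset hφ x.2.left_subset) (by simpa using hψ) hnp
  exact ⟨y, (Finset.subset_insert _ _).trans h1, h1 (by simp), h2 (by simp)⟩

theorem exists_of_know_mem (hCl : IsClosed Cl) (x : CanonicalWorld P Cl) {a : Agent}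
    {φ : Formula Agent Atom} (h : Formula.know a φ ∈ x.R) :
    ∃ y : CanonicalWorld P Cl, boxPart P a x.L ⊆ y.L ∧ φ ∈ y.R := by
  classical
  have hφ := hCl.know a φ (x.2.right_subset h)
  obtain ⟨r, hr, hi⟩ := exists_modal_rule P a x.L φ .unfocused (unfSet x.R)
  rw [insert_unfSet, Finset.insert_eq_of_mem h, ← unfSet_singleton] at hi
  have hnp : ¬ Provable P (mkSeq (boxPart P a x.L) {φ} none) := by
    intro hp
    exact x.2.not_provable (Provable.of_rule (l := [mkSeq (boxPart P a x.L) {φ} none]) hr hi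
      (List.forall_mem_singleton.mpr hp))
  obtain ⟨y, h1, h2⟩ := exists_canonicalWorld hCl
    (hCl.boxPart_subset P a x.2.left_subset) (by simpa using hφ) hnp
  exact ⟨y, h1, h2 (by simp)⟩

/-- The rule `S4_a` hands on `K_a φ` still boxed, and the box is removed by saturation of `y` under
`T_a`; the rule `K_a` removes it at once. -/
theorem mem_of_know_mem {x y : CanonicalWorld P Cl} {a : Agent} {φ : Formula Agent Atom}
    (h : Formula.know a φ ∈ x.L) (hxy : boxPart P a x.L ⊆ y.L) : φ ∈ y.L := by
  by_cases hP : P = .nICKS4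
  · subst hP
    exact y.2.saturated.knowL (by simp) a φ (hxy (mem_boxPart_s4.mpr ⟨h, φ, rfl⟩))
  · exact hxy ((mem_boxPart_of_ne hP).mpr h)

theorem boxPart_subset (hP : P ≠ .nICK) (x : CanonicalWorld P Cl) (a : Agent) :
    boxPart P a x.L ⊆ x.L := by
  intro φ hφ
  by_cases hP' : P = .nICKS4
  · subst hP'
    exact (mem_boxPart_s4.mp hφ).1
  · exact x.2.saturated.knowL hP a φ ((mem_boxPart_of_ne hP').mp hφ)

/-- Formulae are handed on with their box, so they are handed on again at the next step. -/
theorem boxPart_s4_trans {x y z : CanonicalWorld .nICKS4 Cl} {a : Agent}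
    (hxy : boxPart .nICKS4 a x.L ⊆ y.L) (hyz : boxPart .nICKS4 a y.L ⊆ z.L) :
    boxPart .nICKS4 a x.L ⊆ z.L :=
  fun _ hφ => hyz (mem_boxPart_s4.mpr ⟨hxy hφ, (mem_boxPart_s4.mp hφ).2⟩)

/-- Left saturation provides `K_a C φ` for every `a`, so each step carries `C φ` along. -/
theorem common_mem_of_path {x y : CanonicalWorld P Cl} {φ : Formula Agent Atom}
    (h : Formula.common φ ∈ x.L) (hxy : Relation.ReflTransGen Access x y) :
    Formula.common φ ∈ y.L := by
  induction hxy with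
  | refl => exact h
  | tail _ hyz ih =>
    rename_i y z _
    obtain ⟨a, ha⟩ := hyz
    exact mem_of_know_mem ((y.2.saturated.commonL φ ih).2 a) ha

end CanonicalWorld

variable {Cl : Finset (Formula Agent Atom)} {T : Type w} [Nonempty T]

/-- The canonical frame, its worlds being indexed by `T`. The order is inclusion on the left; the
second component only serves to make it antisymmetric. -/
def canonicalFrame (f : T → CanonicalWorld P Cl) : BirelationalFrame.{u, w} Agent where
  World := T × ℕ
  nonempty := inferInstance
  order :=
    { le := fun x y => x = y ∨ x.2 < y.2 ∧ (f x.1).L ⊆ (f y.1).L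
      le_refl := fun _ => Or.inl rfl
      le_trans := by
        rintro x y z (rfl | ⟨h1, h2⟩) (rfl | ⟨h3, h4⟩)
        · exact Or.inl rfl
        · exact Or.inr ⟨h3, h4⟩
        · exact Or.inr ⟨h1, h2⟩
        · exact Or.inr ⟨h1.trans h3, h2.trans h4⟩
      le_antisymm := by
        rintro x y (rfl | ⟨h1, -⟩) (h | ⟨h3, -⟩)
        · rfl
        · rfl
        · exact h.symm
        · omega }
  R := fun a x y => boxPart P a (f x.1).L ⊆ (f y.1).L

theorem canonicalFrame_left_mono (f : T → CanonicalWorld P Cl) {x y : (canonicalFrame f).World}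
    (h : x ≤ y) : (f x.1).L ⊆ (f y.1).L := by
  rcases h with rfl | ⟨-, h⟩
  · exact subset_rfl
  · exact h

theorem canonicalFrame_isEpistemic (f : T → CanonicalWorld P Cl) :
    (canonicalFrame f).IsEpistemic :=
  fun a _ _ _ hxy hyz => (boxPart_mono P a (canonicalFrame_left_mono f hxy)).trans hyz

theorem canonicalFrame_isReflexive (hP : P ≠ .nICK) (f : T → CanonicalWorld P Cl) :
    (canonicalFrame f).IsReflexive :=
  fun a x => (f x.1).boxPart_subset hP a

theorem canonicalFrame_isTransitive (f : T → CanonicalWorld .nICKS4 Cl) :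
    (canonicalFrame f).IsTransitive :=
  fun _ _ _ _ hxy hyz => CanonicalWorld.boxPart_s4_trans hxy hyz

/-- The canonical model: an atom is true where it occurs on the left. -/
def canonicalModel (f : T → CanonicalWorld P Cl) : BirelationalModel.{u, v, w} Agent Atom where
  frame := canonicalFrame f
  val := fun x => {p | Formula.atom p ∈ (f x.1).L}
  val_mono := fun _ _ h _ hp => canonicalFrame_left_mono f h hp

theorem access_of_RStar (f : T → CanonicalWorld P Cl) {x y : (canonicalFrame f).World}
    (h : (canonicalFrame f).RStar x y) :
    Relation.ReflTransGen CanonicalWorld.Access (f x.1) (f y.1) :=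
  Relation.ReflTransGen.lift (fun x : (canonicalFrame f).World => f x.1) (fun _ _ h => h) _ _ h

theorem exists_RStar_of_access {f : T → CanonicalWorld P Cl} (hf : Function.Surjective f)
    {y : CanonicalWorld P Cl} (x : (canonicalFrame f).World)
    (h : Relation.ReflTransGen CanonicalWorld.Access (f x.1) y) :
    ∃ z : (canonicalFrame f).World, (canonicalFrame f).RStar x z ∧ f z.1 = y := by
  induction h with
  | refl => exact ⟨x, .refl, rfl⟩
  | tail _ hyz ih =>
    rename_i y' y _
    obtain ⟨z, hz, rfl⟩ := ih
    obtain ⟨t, rfl⟩ := hf y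
    exact ⟨(t, 0), hz.tail hyz, rfl⟩

/-- Formulae on the left are true and formulae on the right are false. -/
theorem canonicalModel_truth (hCl : IsClosed Cl) {f : T → CanonicalWorld P Cl}
    (hf : Function.Surjective f) (φ : Formula Agent Atom) (x : (canonicalFrame f).World) :
    (φ ∈ (f x.1).L → (canonicalModel f).Sat x φ) ∧
      (φ ∈ (f x.1).R → ¬ (canonicalModel f).Sat x φ) := by
  induction φ generalizing x with
  | bot => exact ⟨fun h => (f x.1).bot_notMem h, fun _ h => h⟩
  | atom p => exact ⟨fun h => h, fun h h' => (f x.1).disjoint h' h⟩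
  | and φ ψ hφ hψ =>
    have hs := (f x.1).2.saturated
    refine ⟨fun h => ?_, fun h h' => ?_⟩
    · exact ⟨(hφ x).1 (hs.andL φ ψ h).1, (hψ x).1 (hs.andL φ ψ h).2⟩
    · rcases hs.andR φ ψ h with h | h
      · exact (hφ x).2 h h'.1
      · exact (hψ x).2 h h'.2
  | or φ ψ hφ hψ =>
    have hs := (f x.1).2.saturated
    refine ⟨fun h => ?_, fun h h' => ?_⟩
    · exact (hs.orL φ ψ h).imp (hφ x).1 (hψ x).1
    · rcases h' with h' | h'
      · exact (hφ x).2 (hs.orR φ ψ h).1 h'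
      · exact (hψ x).2 (hs.orR φ ψ h).2 h'
  | imp φ ψ hφ hψ =>
    refine ⟨fun h y hxy hy => ?_, fun h h' => ?_⟩
    · rcases (f y.1).2.saturated.impL φ ψ (canonicalFrame_left_mono f hxy h) with h | h
      · exact absurd hy ((hφ y).2 h)
      · exact (hψ y).1 h
    · obtain ⟨y, h1, h2, h3⟩ := (f x.1).exists_of_imp_mem hCl h
      obtain ⟨t, rfl⟩ := hf y
      -- The copy one level higher lies above `x` even if both have the same left side.
      exact (hψ (t, x.2 + 1)).2 h3
        (h' (t, x.2 + 1) (Or.inr ⟨Nat.lt_succ_self _, h1⟩) ((hφ (t, x.2 + 1)).1 h2))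
  | know a φ hφ =>
    refine ⟨fun h y hxy => (hφ y).1 (CanonicalWorld.mem_of_know_mem h hxy), fun h h' => ?_⟩
    obtain ⟨y, h1, h2⟩ := (f x.1).exists_of_know_mem hCl h
    obtain ⟨t, rfl⟩ := hf y
    exact (hφ (t, 0)).2 h2 (h' (t, 0) h1)
  | common φ hφ =>
    refine ⟨fun h y hxy => (hφ y).1 ?_, fun h h' => ?_⟩
    · exact ((f y.1).2.saturated.commonL φ
        (CanonicalWorld.common_mem_of_path h (access_of_RStar f hxy))).1
    -- By right saturation either `φ` is refuted here or some `K_a C φ` is, and then the path lemma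
    -- applies.
    · have : ∃ y, Relation.ReflTransGen CanonicalWorld.Access (f x.1) y ∧ φ ∈ y.R := by
        rcases (f x.1).2.saturated.commonR φ h with h | ⟨a, h⟩
        · exact ⟨f x.1, .refl, h⟩
        · exact (f x.1).exists_path hCl a φ h
      obtain ⟨y, h1, h2⟩ := this
      obtain ⟨z, hz, rfl⟩ := exists_RStar_of_access hf x h1
      exact (hφ z).2 h2 (h' z hz)

/-! ### Completeness -/

omit [Fintype Agent] in
theorem sat_bigAnd (M : BirelationalModel.{u, v, w} Agent Atom) (x : M.frame.World)
    (l : List (Formula Agent Atom)) (h : ∀ φ ∈ l, M.Sat x φ) : M.Sat x (.bigAnd l) := by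
  induction l with
  | nil => exact fun _ _ h => h
  | cons φ l ih => exact ⟨h φ (by simp), ih fun ψ hψ => h ψ (by simp [hψ])⟩

omit [Fintype Agent] in
theorem exists_sat_of_sat_bigOr (M : BirelationalModel.{u, v, w} Agent Atom) (x : M.frame.World)
    (l : List (Formula Agent Atom)) (h : M.Sat x (.bigOr l)) : ∃ φ ∈ l, M.Sat x φ := by
  induction l with
  | nil => exact h.elim
  | cons φ l ih =>
    rcases h with h | h
    · exact ⟨φ, by simp, h⟩
    · obtain ⟨ψ, hψ, h⟩ := ih h
      exact ⟨ψ, by simp [hψ], h⟩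

/-- The rule `u` drops the focus, so unfocused sequents suffice for the model construction. -/
theorem provable_of_provable_plain (σ : Sequent Agent Atom)
    (h : Provable P (mkSeq (plain σ.left) (plain σ.right) none)) : Provable P σ := by
  classical
  have hL : unfSet (plain σ.left) = σ.left := by
    ext ⟨φ, α⟩
    simp only [mem_unfSet, plain, Finset.mem_image]
    constructor
    · rintro ⟨⟨⟨φ, β⟩, h1, rfl⟩, rfl⟩
      obtain rfl : β = .unfocused := σ.left_unfocused _ h1
      exact h1
    · intro h1
      exact ⟨⟨_, h1, rfl⟩, σ.left_unfocused _ h1⟩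
  by_cases hfoc : ∃ χ, foc χ ∈ σ.right
  · obtain ⟨χ, hχ⟩ := hfoc
    refine Provable.of_rule (r := .unfocus) (l := [_]) (by cases P <;> trivial) ?_
      (List.forall_mem_singleton.mpr h)
    -- The focused formula is erased from the side formulae, as otherwise it would survive in the
    -- premise.
    have := RuleInstance.unfocus σ.left (σ.right.erase (foc χ)) χ
    rw [Finset.insert_erase hχ] at this
    convert this using 2
    simp only [List.map_cons, List.map_nil, List.cons.injEq, and_true, mkSeq_toPreSequent, hL,
      focSet, PreSequent.mk.injEq, true_and]
    ext ⟨φ, α⟩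
    simp only [mem_unfSet, plain, Finset.mem_image, Finset.mem_insert, Finset.mem_erase]
    constructor
    · rintro ⟨⟨⟨φ, β⟩, h1, rfl⟩, rfl⟩
      cases β with
      | unfocused => exact Or.inr ⟨by simp, h1⟩
      | focused =>
        left
        have := σ.focus_unique _ h1 _ hχ rfl rfl
        simp only [Prod.mk.injEq, and_true] at this
        rw [this]
    · rintro (h1 | ⟨h1, h2⟩)
      · obtain ⟨rfl, rfl⟩ := Prod.mk.inj h1
        exact ⟨⟨_, hχ, rfl⟩, rfl⟩
      · refine ⟨⟨_, h2, rfl⟩, ?_⟩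
        cases α with
        | unfocused => rfl
        | focused => exact absurd (σ.focus_unique _ h2 _ hχ rfl rfl) h1
  · have hR : unfSet (plain σ.right) = σ.right := by
      have hu : ∀ x ∈ σ.right, x.2 = .unfocused := by
        rintro ⟨φ, α⟩ hx
        cases α with
        | unfocused => rfl
        | focused => exact absurd ⟨φ, hx⟩ hfoc
      ext ⟨φ, α⟩
      simp only [mem_unfSet, plain, Finset.mem_image]
      constructor
      · rintro ⟨⟨⟨φ, β⟩, h1, rfl⟩, rfl⟩
        obtain rfl : β = .unfocused := hu _ h1
        exact h1
      · intro h1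
        exact ⟨⟨_, h1, rfl⟩, hu _ h1⟩
    have : mkSeq (plain σ.left) (plain σ.right) none = σ := Sequent.ext hL hR
    rwa [this] at h

/-- Completeness over every class that contains the canonical frames. -/
theorem provable_of_validOver (σ : Sequent Agent Atom) (𝓕 : Set (BirelationalFrame.{u, w} Agent))
    (h𝓕 : ∀ (Cl : Finset (Formula Agent Atom)) (T : Type w) [Nonempty T]
      (f : T → CanonicalWorld P Cl), canonicalFrame f ∈ 𝓕)
    (h : σ.ValidOver 𝓕) : Provable P σ := by
  classical
  by_contra hnp
  obtain ⟨Cl, hCl, hsub⟩ := exists_isClosed (plain σ.left ∪ plain σ.right)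
  obtain ⟨x, hx1, hx2⟩ := exists_canonicalWorld (P := P) hCl
    (Finset.subset_union_left.trans hsub) (Finset.subset_union_right.trans hsub)
    fun hp => hnp (provable_of_provable_plain σ hp)
  -- Countable types are small in every universe, so the model can be built in the universe over
  -- which validity is assumed.
  have : Countable (CanonicalWorld P Cl) := Finite.to_countable
  let e := equivShrink.{w} (CanonicalWorld P Cl)
  have : Nonempty (Shrink.{w} (CanonicalWorld P Cl)) := ⟨e x⟩
  let f : Shrink.{w} (CanonicalWorld P Cl) → CanonicalWorld P Cl := e.symm
  have htruth := fun φ => canonicalModel_truth hCl (f := f) e.symm.surjective φ (e x, 0)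
  have hfx : f (e x) = x := e.symm_apply_apply x
  simp only [hfx] at htruth
  have hsat := h (canonicalModel f) (h𝓕 Cl _ f) (e x, 0)
  obtain ⟨φ, hφ, hφ'⟩ := exists_sat_of_sat_bigOr _ _ _ (hsat (e x, 0) le_rfl
    (sat_bigAnd _ _ _ fun φ hφ => (htruth φ).1 (hx1 (Finset.mem_toList.mp hφ))))
  exact (htruth φ).2 (hx2 (Finset.mem_toList.mp hφ)) hφ'

end ICK

theorem mainTheorem7 {Agent : Type u} [Fintype Agent] [Nonempty Agent] {Atom : Type v}
    [Countable Atom] [Infinite Atom] (σ : ICK.Sequent Agent Atom) :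
    (σ.ValidOver (ICK.epistemicFrames.{u, w} Agent) → ICK.Provable .nICK σ) ∧
    (σ.ValidOver (ICK.reflexiveFrames.{u, w} Agent) → ICK.Provable .nICKT σ) ∧
    (σ.ValidOver (ICK.s4Frames.{u, w} Agent) → ICK.Provable .nICKS4 σ) := by
  refine ⟨ICK.provable_of_validOver σ _ fun Cl T _ f => ICK.canonicalFrame_isEpistemic f,
    ICK.provable_of_validOver σ _ fun Cl T _ f => ⟨ICK.canonicalFrame_isEpistemic f,
      ICK.canonicalFrame_isReflexive (by simp) f⟩,
    ICK.provable_of_validOver σ _ fun Cl T _ f => ⟨ICK.canonicalFrame_isEpistemic f,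
      ICK.canonicalFrame_isReflexive (by simp) f, ICK.canonicalFrame_isTransitive f⟩⟩
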